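/- Let $\omega_1,\omega_2\in\mathbb C$ with $\tau:=\omega_2/\omega_1$ in the upper half plane, $\Lambda=2\omega_1\mathbb Z+2\omega_2\mathbb Z$, let $\sigma(z)=z\prod_{l\in\Lambda\setminus\{0\}}(1-\tfrac zl)\,e^{z/l+z^2/(2l^2)}$ be the Weierstrass sigma function of $\Lambda$, $\zeta=\sigma'/\sigma$, $\eta_1=\zeta(\omega_1)$, and $\theta_1(z)=\sum_{k\in\mathbb Z}\exp\big[2\pi i\big((z+\tfrac12)(k+\tfrac12)+\tfrac12(k+\tfrac12)^2\tau\big)\big]$. Let $\sigma_0=\sigma$ and $\sigma_r(z)=e^{-\zeta(\rho_r)z}\sigma(z+\rho_r)/\sigma(\rho_r)$ for $r=1,2,3$, with the half periods $\rho_1=\omega_1$, $\rho_2=-\omega_1-\omega_2$, $\rho_3=\omega_2$. For $\hbar\in\mathbb C$ define operators on functions $f$ of $(\lambda_1,\lambda_2)\in\mathbb C^2$, with $T_{\pm1}^{a}$, $T_{\pm2}^{a}$ denoting the shift of the first, resp. second, variable by $\pm a$: $$\widetilde M_1=\sum_{\epsilon=\pm1}\ \prod_{\delta=\pm1}\frac{\theta_1(\epsilon\lambda_1+\delta\lambda_2-\hbar)}{\theta_1(\epsilon\lambda_1+\delta\lambda_2)}\,T^{\hbar}_{\epsilon1}+\sum_{\epsilon=\pm1}\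 \prod_{\delta=\pm1}\frac{\theta_1(\epsilon\lambda_2+\delta\lambda_1-\hbar)}{\theta_1(\epsilon\lambda_2+\delta\lambda_1)}\,T^{\hbar}_{\epsilon2},$$ $$\widetilde M_2=\sum_{\epsilon,\delta=\pm1}\left(\frac{\theta_1(z_{\epsilon\delta}-\hbar)}{\theta_1(z_{\epsilon\delta}+\hbar)}\,T^{\hbar}_{\epsilon1}T^{\hbar}_{\delta2}+\frac{\theta_1(z_{\epsilon\delta}-\hbar)\,\theta_1(z_{\epsilon\delta}+2\hbar)}{\theta_1(z_{\epsilon\delta})\,\theta_1(z_{\epsilon\delta}+\hbar)}\right),\qquad z_{\epsilon\delta}=\epsilon\lambda_1+\delta\lambda_2 .$$ For complex parameters $\gamma,\mu,\mu_r,\mu_r'$ $(r=0,1,2,3)$ put, as meromorphic functions, $v(z)=\sigma(z+\mu)/\sigma(z)$ and $w(z)=\prod_{r=0}^3\frac{\sigma_r(z+\mu_r)\,\sigma_r(z+\mu_r'+\gamma/2)}{\sigma_r(z)\,\sigma_r(z+\gamma/2)}$, and $$A_1=\sum_{\epsilon=\pm1}w(\epsilon x_1)v(\epsilon x_1+x_2)v(\epsilon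 x_1-x_2)T^\gamma_{\epsilon1},\qquad A_2=\sum_{\epsilon=\pm1}w(\epsilon x_2)v(\epsilon x_2+x_1)v(\epsilon x_2-x_1)T^\gamma_{\epsilon2}.$$ Van Diejen's operators are $\mathcal H_1=A_1+A_2+U_{\{1,2\},1}$ and $$\mathcal H_2=\sum_{\epsilon,\delta=\pm1}w(\epsilon x_1)w(\delta x_2)v(\epsilon x_1+\delta x_2)v(\epsilon x_1+\delta x_2+\gamma)T^\gamma_{\epsilon1}T^\gamma_{\delta2}+U_{\{2\},1}A_1+U_{\{1\},1}A_2+U_{\{1,2\},2},$$ where $U_{\{j\},1}=-w(x_j)-w(-x_j)$, $$U_{\{1,2\},1}=\sum_{r=0}^3c_r\prod_{j=1,2}\frac{\sigma_r(\mu-\gamma/2+x_j)\,\sigma_r(\mu-\gamma/2-x_j)}{\sigma_r(-\gamma/2+x_j)\,\sigma_r(-\gamma/2-x_j)},\qquad c_r=\frac{2}{\sigma(\mu)\sigma(\mu-\gamma)}\prod_{s=0}^3\sigma_s(\mu_{\pi_r(s)}-\gamma/2)\,\sigma_s(\mu'_{\pi_r(s)}),$$ $$U_{\{1,2\},2}=\sum_{\epsilon,\delta=\pm1}w(\epsilon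 x_1)w(\delta x_2)v(\epsilon x_1+\delta x_2)v(-\epsilon x_1-\delta x_2-\gamma),$$ with $\pi_0=\mathrm{id}$, $\pi_1=(01)(23)$, $\pi_2=(02)(13)$, $\pi_3=(03)(12)$. Let $\bar{\mathcal H}_1,\bar{\mathcal H}_2$ be the specializations of $\mathcal H_1,\mathcal H_2$ at $\mu=-\gamma$, $\mu_r=\mu'_r=0$; the coefficients $c_r$ are then taken to be $0$ also when $\sigma(\mu)\sigma(\mu-\gamma)=0$. Let $\varphi$ be the bijection $\varphi(f)(x_1,x_2)=\exp\!\big(\eta_1(x_1^2+x_2^2)/\omega_1\big)\,f\big(\tfrac{x_1}{2\omega_1},\tfrac{x_2}{2\omega_1}\big)$ of the space of functions of two complex variables, and let $\gamma=2\omega_1\hbar$. Then $$\varphi\,\widetilde M_1\,\varphi^{-1}=e^{-2\eta_1\gamma^2/\omega_1}\,\bar{\mathcal H}_1,\qquad \varphi\,\widetilde M_2\,\varphi^{-1}=e^{-2\eta_1\gamma^2/\omega_1}\,\big(\bar{\mathcal H}_2+2\bar{\mathcal H}_1\big).$$ These identities hold for every function $g$ of $(x_1,x_2)$ to which both sides are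 applied, at every point $(x_1,x_2)$ with $x_1\pm x_2\notin\Lambda$ for the first one, and with $z,\,z+\gamma,\,z-\gamma\notin\Lambda$ for both $z=x_1+x_2$ and $z=x_1-x_2$ for the second one. -/

import Mathlib

noncomputable section

namespace EllipticC2

/-! ### Theta and sigma functions -/

/-- The Jacobi theta function `θ₁(z|τ)`, with quasi-periods `1` and `τ`. -/
def theta1 (τ z : ℂ) : ℂ :=
  ∑' k : ℤ, Complex.exp (2 * Real.pi * Complex.I *
    ((z + 1 / 2) * ((k : ℂ) + 1 / 2) + 1 / 2 * ((k : ℂ) + 1 / 2) ^ 2 * τ))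

/-- The Weierstrass sigma function of the period lattice `Λ` of `L`:
`σ(z) = z ∏_{l ∈ Λ, l ≠ 0} (1 - z/l) exp (z/l + z²/(2l²))`.
(The factor with index `l = 0` equals `1`, because `z / 0 = 0` in Lean.) -/
def sigma (L : PeriodPair) (z : ℂ) : ℂ :=
  z * ∏' l : L.lattice, (1 - z / (l : ℂ)) * Complex.exp (z / (l : ℂ) + z ^ 2 / (2 * (l : ℂ) ^ 2))

/-- The Weierstrass zeta function `ζ = σ'/σ`. -/
def zeta (L : PeriodPair) : ℂ → ℂ := logDeriv (sigma L)

/-- The half period `ω₁`. The fields `L.ω₁`, `L.ω₂` of `L` are the full periods, i.e. the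
numbers `2ω₁`, `2ω₂` of the usual notation. -/
def halfω₁ (L : PeriodPair) : ℂ := L.ω₁ / 2

/-- The half period `ω₂`. -/
def halfω₂ (L : PeriodPair) : ℂ := L.ω₂ / 2

/-- `η₁ = ζ(ω₁)`. -/
def eta1 (L : PeriodPair) : ℂ := zeta L (halfω₁ L)

/-- The sigma function shifted by a half period `ω`: `e^{-ζ(ω) z} σ(z + ω) / σ(ω)`. -/
def sigmaShift (L : PeriodPair) (ω z : ℂ) : ℂ :=
  Complex.exp (-zeta L ω * z) * sigma L (z + ω) / sigma L ω

/-- The functions `σ₀ = σ, σ₁, σ₂, σ₃`. The last three are numbered so that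
`σ_r(z) = exp (η₁ z² / (2ω₁)) θ_{r+1}(z/(2ω₁)) / θ_{r+1}(0)`: they belong to the half periods
`ω₁`, `-ω₁-ω₂`, `ω₂` respectively. -/
def sigmaR (L : PeriodPair) : Fin 4 → ℂ → ℂ :=
  ![sigma L, sigmaShift L (halfω₁ L), sigmaShift L (-halfω₁ L - halfω₂ L),
    sigmaShift L (halfω₂ L)]

/-! ### The operators of type `C₂`

A function on `𝔥` is written as a function of the coordinates `λ₁, λ₂`. The weights
`±ε_i` give `λ_{±ε_i} = ±λ_i`, and `T_{±2ε_i}` shifts `λ_i` by `±h`. A sign is an element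
of `ℤˣ = {1, -1}`. -/

/-- The sign `ε`, as a complex number. -/
def sgn (ε : ℤˣ) : ℂ := ((ε : ℤ) : ℂ)

/-- The operator `M̃₁`: the sum over `p = ±ε₁, ±ε₂` of
`∏_{q ≠ ±p} θ₁(λ_{p+q} - h) / θ₁(λ_{p+q}) · T_{2p}`. -/
def M1 (τ h : ℂ) (f : ℂ × ℂ → ℂ) (l : ℂ × ℂ) : ℂ :=
  (∑ ε : ℤˣ, (∏ δ : ℤˣ, theta1 τ (sgn ε * l.1 + sgn δ * l.2 - h) /
      theta1 τ (sgn ε * l.1 + sgn δ * l.2)) * f (l.1 + sgn ε * h, l.2)) +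
  ∑ ε : ℤˣ, (∏ δ : ℤˣ, theta1 τ (sgn ε * l.2 + sgn δ * l.1 - h) /
      theta1 τ (sgn ε * l.2 + sgn δ * l.1)) * f (l.1, l.2 + sgn ε * h)

/-- The operator `M̃₂`: the sum over `p = ±ε₁`, `q = ±ε₂` of
`θ₁(λ_{p+q} - h) / θ₁(λ_{p+q} + h) · T_{2p} T_{2q}
  + θ₁(λ_{p+q} - h) θ₁(λ_{p+q} + 2h) / (θ₁(λ_{p+q}) θ₁(λ_{p+q} + h))`. -/
def M2 (τ h : ℂ) (f : ℂ × ℂ → ℂ) (l : ℂ × ℂ) : ℂ :=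
  ∑ ε : ℤˣ, ∑ δ : ℤˣ,
    (theta1 τ (sgn ε * l.1 + sgn δ * l.2 - h) / theta1 τ (sgn ε * l.1 + sgn δ * l.2 + h) *
        f (l.1 + sgn ε * h, l.2 + sgn δ * h) +
      theta1 τ (sgn ε * l.1 + sgn δ * l.2 - h) * theta1 τ (sgn ε * l.1 + sgn δ * l.2 + 2 * h) /
        (theta1 τ (sgn ε * l.1 + sgn δ * l.2) * theta1 τ (sgn ε * l.1 + sgn δ * l.2 + h)) *
        f l)

/-! ### Van Diejen's operators

`μ`, `m r = μ_r`, `m' r = μ'_r` (`r = 0, 1, 2, 3`) are the coupling parameters and `γ` is the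
step. The functions `v` and `w` below are meromorphic functions on `ℂ`. -/

/-- `v(z) = σ(z + μ) / σ(z)`. -/
def v (L : PeriodPair) (μ z : ℂ) : ℂ := sigma L (z + μ) / sigma L z

/-- `w(z) = ∏_r σ_r(z + μ_r) σ_r(z + μ'_r + γ/2) / (σ_r(z) σ_r(z + γ/2))`, as a meromorphic
function: its value at a removable singularity is the limit there. -/
def w (L : PeriodPair) (γ : ℂ) (m m' : Fin 4 → ℂ) : ℂ → ℂ :=
  toMeromorphicNFOn
    (fun z => ∏ r : Fin 4, sigmaR L r (z + m r) * sigmaR L r (z + m' r + γ / 2) /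
      (sigmaR L r z * sigmaR L r (z + γ / 2))) Set.univ

/-- The permutations `π₀ = id`, `π₁ = (01)(23)`, `π₂ = (02)(13)`, `π₃ = (03)(12)`. -/
def perm : Fin 4 → Equiv.Perm (Fin 4) :=
  ![1, Equiv.swap 0 1 * Equiv.swap 2 3, Equiv.swap 0 2 * Equiv.swap 1 3,
    Equiv.swap 0 3 * Equiv.swap 1 2]

/-- The constants `c_r`. -/
def c (L : PeriodPair) (γ μ : ℂ) (m m' : Fin 4 → ℂ) (r : Fin 4) : ℂ :=
  2 / (sigma L μ * sigma L (μ - γ)) *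
    ∏ s : Fin 4, sigmaR L s (m (perm r s) - γ / 2) * sigmaR L s (m' (perm r s))

/-- `U_{{j},1} = -w(x_j) - w(-x_j)`, as a function of `z = x_j`. -/
def USingle (L : PeriodPair) (γ : ℂ) (m m' : Fin 4 → ℂ) (z : ℂ) : ℂ :=
  -w L γ m m' z - w L γ m m' (-z)

/-- `U_{{1,2},1}`. -/
def UPairOne (L : PeriodPair) (γ μ : ℂ) (m m' : Fin 4 → ℂ) (x : ℂ × ℂ) : ℂ :=
  ∑ r : Fin 4, c L γ μ m m' r *
    ((sigmaR L r (μ - γ / 2 + x.1) * sigmaR L r (μ - γ / 2 - x.1) /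
        (sigmaR L r (-γ / 2 + x.1) * sigmaR L r (-γ / 2 - x.1))) *
      (sigmaR L r (μ - γ / 2 + x.2) * sigmaR L r (μ - γ / 2 - x.2) /
        (sigmaR L r (-γ / 2 + x.2) * sigmaR L r (-γ / 2 - x.2))))

/-- `U_{{1,2},2}`. -/
def UPairTwo (L : PeriodPair) (γ μ : ℂ) (m m' : Fin 4 → ℂ) (x : ℂ × ℂ) : ℂ :=
  ∑ ε : ℤˣ, ∑ δ : ℤˣ, w L γ m m' (sgn ε * x.1) * w L γ m m' (sgn δ * x.2) *
    v L μ (sgn ε * x.1 + sgn δ * x.2) * v L μ (-(sgn ε * x.1) - sgn δ * x.2 - γ)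

/-- The operator `∑_{ε = ±1} w(ε x₁) v(ε x₁ + x₂) v(ε x₁ - x₂) T_{ε1}^γ`. -/
def shiftOne (L : PeriodPair) (γ μ : ℂ) (m m' : Fin 4 → ℂ) (g : ℂ × ℂ → ℂ) (x : ℂ × ℂ) : ℂ :=
  ∑ ε : ℤˣ, w L γ m m' (sgn ε * x.1) * v L μ (sgn ε * x.1 + x.2) * v L μ (sgn ε * x.1 - x.2) *
    g (x.1 + sgn ε * γ, x.2)

/-- The operator `∑_{ε = ±1} w(ε x₂) v(ε x₂ + x₁) v(ε x₂ - x₁) T_{ε2}^γ`. -/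
def shiftTwo (L : PeriodPair) (γ μ : ℂ) (m m' : Fin 4 → ℂ) (g : ℂ × ℂ → ℂ) (x : ℂ × ℂ) : ℂ :=
  ∑ ε : ℤˣ, w L γ m m' (sgn ε * x.2) * v L μ (sgn ε * x.2 + x.1) * v L μ (sgn ε * x.2 - x.1) *
    g (x.1, x.2 + sgn ε * γ)

/-- Van Diejen's first order operator `𝓗₁`. -/
def H1 (L : PeriodPair) (γ μ : ℂ) (m m' : Fin 4 → ℂ) (g : ℂ × ℂ → ℂ) (x : ℂ × ℂ) : ℂ :=
  shiftOne L γ μ m m' g x + shiftTwo L γ μ m m' g x + UPairOne L γ μ m m' x * g x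

/-- Van Diejen's second order operator `𝓗₂`. -/
def H2 (L : PeriodPair) (γ μ : ℂ) (m m' : Fin 4 → ℂ) (g : ℂ × ℂ → ℂ) (x : ℂ × ℂ) : ℂ :=
  (∑ ε : ℤˣ, ∑ δ : ℤˣ, w L γ m m' (sgn ε * x.1) * w L γ m m' (sgn δ * x.2) *
    v L μ (sgn ε * x.1 + sgn δ * x.2) * v L μ (sgn ε * x.1 + sgn δ * x.2 + γ) *
    g (x.1 + sgn ε * γ, x.2 + sgn δ * γ)) +
  USingle L γ m m' x.2 * shiftOne L γ μ m m' g x +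
  USingle L γ m m' x.1 * shiftTwo L γ μ m m' g x +
  UPairTwo L γ μ m m' x * g x

/-- `𝓗̄₁`: the specialization `μ = -γ`, `μ_r = μ'_r = 0` of `𝓗₁`. -/
def H1bar (L : PeriodPair) (γ : ℂ) : (ℂ × ℂ → ℂ) → ℂ × ℂ → ℂ := H1 L γ (-γ) 0 0

/-- `𝓗̄₂`: the specialization `μ = -γ`, `μ_r = μ'_r = 0` of `𝓗₂`. -/
def H2bar (L : PeriodPair) (γ : ℂ) : (ℂ × ℂ → ℂ) → ℂ × ℂ → ℂ := H2 L γ (-γ) 0 0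

/-! ### The gauge map -/

lemma halfω₁_ne_zero (L : PeriodPair) : halfω₁ L ≠ 0 := by
  have h : L.ω₁ ≠ 0 := by simpa using L.indep.ne_zero 0
  exact div_ne_zero h two_ne_zero

/-- The bijection `φ(f)(x₁, x₂) = exp (η₁ (x₁² + x₂²) / ω₁) f(x₁/(2ω₁), x₂/(2ω₁))`
on the functions of two complex variables. -/
def gauge (L : PeriodPair) : (ℂ × ℂ → ℂ) ≃ (ℂ × ℂ → ℂ) where
  toFun f x := Complex.exp (eta1 L * (x.1 ^ 2 + x.2 ^ 2) / halfω₁ L) *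
    f (x.1 / (2 * halfω₁ L), x.2 / (2 * halfω₁ L))
  invFun g l :=
    Complex.exp (-(eta1 L * ((2 * halfω₁ L * l.1) ^ 2 + (2 * halfω₁ L * l.2) ^ 2) / halfω₁ L)) *
      g (2 * halfω₁ L * l.1, 2 * halfω₁ L * l.2)
  left_inv f := by
    have h := halfω₁_ne_zero L
    funext l
    simp [← mul_assoc, ← Complex.exp_add, h]
  right_inv g := by
    have h := halfω₁_ne_zero L
    funext x
    have h1 : 2 * halfω₁ L * (x.1 / (2 * halfω₁ L)) = x.1 := by field_simp
    have h2 : 2 * halfω₁ L * (x.2 / (2 * halfω₁ L)) = x.2 := by field_simp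
    simp only [h1, h2, ← mul_assoc, ← Complex.exp_add]
    simp

end EllipticC2

end

noncomputable section

namespace EllipticC2

open Filter Topology Complex

/-! ### Entire functions given by infinite products -/

/-! Everything rests on `exists_theta1_eq_mul_sigma`: up to a nonzero constant, θ₁(z/(2ω₁)) is
exp(-A z²/2) σ(z) with A = η₁/ω₁. In a quotient of two theta values the constant cancels, leaving
the sigma quotient times the exponential of a quadratic form. In each term of the operators these
exponents combine with those of the gauge factor, before and after the shift, to the same number
-2Aγ².

On the van Diejen side, w becomes 1 and every c_r becomes 0, since each contains the factor σ(0).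
Hence U_{{j},1} = -2, and adding 2𝓗̄₁ to 𝓗̄₂ removes the single shifts. Both identities can then be
compared term by term.

For the theta-sigma relation, θ₁ and σ are both compared with P(z) = sin(πu) ∏ (1 - qⁿe^{2πiu})(1 -
qⁿe^{-2πiu}), u = z/(2ω₁), n ≥ 1, whose zeros are visible. The quotient θ₁/P is elliptic with
removable singularities, hence constant by Liouville (`eq_const_of_periodic`). Likewise (log P)'' +
℘ is elliptic without poles, hence constant, while (log σ)'' = -℘ by differentiating the product. So
P'/P - σ'/σ is affine in z; oddness and the value at ω₁ show that it is -Az, and integration gives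
the relation. -/

lemma tendstoLocallyUniformlyOn_prod_one_add {ι : Type*} {f : ι → ℂ → ℂ}
    (hf : ∀ i, Differentiable ℂ (f i))
    (hb : ∀ R : ℝ, ∃ u : ι → ℝ, Summable u ∧ ∀ᶠ i in cofinite, ∀ z, ‖z‖ ≤ R → ‖f i z‖ ≤ u i) :
    TendstoLocallyUniformlyOn (fun (s : Finset ι) z ↦ ∏ i ∈ s, (1 + f i z))
      (fun z ↦ ∏' i, (1 + f i z)) atTop Set.univ := by
  have : HasProdLocallyUniformlyOn (fun i z ↦ 1 + f i z) (fun z ↦ ∏' i, (1 + f i z)) Set.univ := by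
    refine hasProdLocallyUniformlyOn_of_forall_compact isOpen_univ fun K _ hK ↦ ?_
    obtain ⟨R, hR⟩ := hK.isBounded.exists_norm_le
    obtain ⟨u, hu, h⟩ := hb R
    exact hu.hasProdUniformlyOn_one_add hK (h.mono fun i hi z hz ↦ hi z (hR z hz))
      fun i ↦ (hf i).continuous.continuousOn
  exact hasProdLocallyUniformlyOn_iff_tendstoLocallyUniformlyOn.mp this

lemma differentiable_tprod_one_add {ι : Type*} {f : ι → ℂ → ℂ}
    (hf : ∀ i, Differentiable ℂ (f i))
    (hb : ∀ R : ℝ, ∃ u : ι → ℝ, Summable u ∧ ∀ᶠ i in cofinite, ∀ z, ‖z‖ ≤ R → ‖f i z‖ ≤ u i) :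
    Differentiable ℂ (fun z ↦ ∏' i, (1 + f i z)) := by
  rw [← differentiableOn_univ]
  refine (tendstoLocallyUniformlyOn_prod_one_add hf hb).differentiableOn
    (Eventually.of_forall fun s ↦ ?_) isOpen_univ
  exact (Differentiable.fun_finsetProd fun i _ ↦ (hf i).const_add 1).differentiableOn

lemma summable_norm_of_eventually_le {ι : Type*} {f : ι → ℂ → ℂ}
    (hb : ∀ R : ℝ, ∃ u : ι → ℝ, Summable u ∧ ∀ᶠ i in cofinite, ∀ z, ‖z‖ ≤ R → ‖f i z‖ ≤ u i)
    (z : ℂ) : Summable fun i ↦ ‖f i z‖ := by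
  obtain ⟨u, hu, h⟩ := hb ‖z‖
  exact hu.of_norm_bounded_eventually (h.mono fun i hi ↦ by simpa using hi z le_rfl)

/-! ### Second logarithmic derivatives under locally uniform limits -/

lemma deriv_logDeriv_eq {g : ℂ → ℂ} {z : ℂ} (hg : DifferentiableAt ℂ g z)
    (hg' : DifferentiableAt ℂ (deriv g) z) (h : g z ≠ 0) :
    deriv (logDeriv g) z = (deriv (deriv g) z * g z - deriv g z * deriv g z) / g z ^ 2 := by
  have : logDeriv g = fun z ↦ deriv g z / g z := rfl
  rw [this, deriv_fun_div hg' hg h]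

lemma differentiable_deriv {g : ℂ → ℂ} (hg : Differentiable ℂ g) : Differentiable ℂ (deriv g) :=
  fun z ↦ (hg.analyticAt z).deriv.differentiableAt

/-- Locally uniform convergence of holomorphic functions passes to f' and f'', and (log f)'' is a
rational expression in f, f', f''. This allows the sigma product to be differentiated termwise. -/
lemma tendsto_deriv_logDeriv {ι : Type*} {p : Filter ι} {f : ι → ℂ → ℂ} {g : ℂ → ℂ} {z : ℂ}
    (hF : TendstoLocallyUniformlyOn f g p Set.univ) (hf : ∀ i, Differentiable ℂ (f i))
    (hg : Differentiable ℂ g) (hz : g z ≠ 0) :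
    Tendsto (fun i ↦ deriv (logDeriv (f i)) z) p (𝓝 (deriv (logDeriv g) z)) := by
  have h1 := hF.deriv (.of_forall fun i ↦ (hf i).differentiableOn) isOpen_univ
  have h2 := h1.deriv (.of_forall fun i ↦ (differentiable_deriv (hf i)).differentiableOn)
    isOpen_univ
  have t0 := hF.tendsto_at (Set.mem_univ z)
  have t1 := h1.tendsto_at (Set.mem_univ z)
  have t2 := h2.tendsto_at (Set.mem_univ z)
  rw [deriv_logDeriv_eq (hg z) (differentiable_deriv hg z) hz]
  refine (((t2.mul t0).sub (t1.mul t1)).div (t0.pow 2) (pow_ne_zero 2 hz)).congr' ?_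
  filter_upwards [t0.eventually_ne hz] with i hi
  rw [deriv_logDeriv_eq (hf i z) (differentiable_deriv (hf i) z) hi]
  rfl

/-! ### The Weierstrass sigma function -/

/-- The derivative of (1 - t)e^{t + t²/2} collapses to -t²e^{t + t²/2}, so the mean value inequality
on the disc of radius |u| gives a cubic bound; 3/2 bounds |t + t²/2| there. -/
lemma norm_primaryFactor_sub_one_le {u : ℂ} (hu : ‖u‖ ≤ 1) :
    ‖(1 - u) * exp (u + u ^ 2 / 2) - 1‖ ≤ Real.exp (3 / 2) * ‖u‖ ^ 3 := by
  have hd (t : ℂ) : HasDerivAt (fun t : ℂ ↦ (1 - t) * exp (t + t ^ 2 / 2))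
      (-t ^ 2 * exp (t + t ^ 2 / 2)) t := by
    have h1 : HasDerivAt (fun t : ℂ ↦ 1 - t) (-1) t := by
      simpa using (hasDerivAt_id t).const_sub 1
    have h2 : HasDerivAt (fun t : ℂ ↦ t + t ^ 2 / 2) (1 + t) t := by
      have := (hasDerivAt_id t).add (((hasDerivAt_id t).pow 2).div_const 2)
      convert! this using 1
      simp
    convert! h1.mul h2.cexp using 1
    ring
  have hbound : ∀ t ∈ Metric.closedBall (0 : ℂ) ‖u‖,
      ‖-t ^ 2 * exp (t + t ^ 2 / 2)‖ ≤ Real.exp (3 / 2) * ‖u‖ ^ 2 := by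
    intro t ht
    have ht : ‖t‖ ≤ ‖u‖ := by simpa using ht
    have h1 : ‖t + t ^ 2 / 2‖ ≤ 3 / 2 := by
      refine (norm_add_le _ _).trans ?_
      rw [norm_div, norm_pow]
      have : ‖t‖ ^ 2 ≤ 1 := pow_le_one₀ (norm_nonneg _) (ht.trans hu)
      simp only [Complex.norm_ofNat]
      linarith
    rw [norm_mul, norm_neg, norm_pow, mul_comm, Complex.norm_exp]
    gcongr
    exact (re_le_norm _).trans h1
  have := (convex_closedBall (0 : ℂ) ‖u‖).norm_image_sub_le_of_norm_hasDerivWithin_le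
    (fun t _ ↦ (hd t).hasDerivWithinAt) hbound (x := 0) (y := u) (by simp) (by simp)
  simp only [sub_zero, one_mul] at this
  simp only [zero_pow two_ne_zero, zero_div, add_zero, exp_zero] at this
  exact this.trans (by rw [pow_succ ‖u‖ 2, mul_assoc])

/-- The factor of the Weierstrass product of `σ` that belongs to a lattice point. -/
def sigmaFactor (l z : ℂ) : ℂ := (1 - z / l) * exp (z / l + z ^ 2 / (2 * l ^ 2))

/-- The entire function `σ(z) / z`. -/
def sigmaProd (L : PeriodPair) (z : ℂ) : ℂ := ∏' l : L.lattice, sigmaFactor l z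

lemma sigma_eq (L : PeriodPair) (z : ℂ) : sigma L z = z * sigmaProd L z := rfl

@[fun_prop]
lemma differentiable_sigmaFactor (l : ℂ) : Differentiable ℂ (sigmaFactor l) := by
  unfold sigmaFactor
  fun_prop

lemma sigmaFactor_zero_left (z : ℂ) : sigmaFactor 0 z = 1 := by simp [sigmaFactor]

lemma sigmaFactor_ne_zero {l z : ℂ} (h : l ≠ 0 → z ≠ l) : sigmaFactor l z ≠ 0 := by
  rcases eq_or_ne l 0 with rfl | hl
  · simp [sigmaFactor_zero_left]
  · refine mul_ne_zero (fun h0 ↦ h hl ?_) (exp_ne_zero _)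
    rw [sub_eq_zero, eq_comm, div_eq_one_iff_eq hl] at h0
    exact h0

lemma exists_sigmaFactor_bound (L : PeriodPair) (R : ℝ) :
    ∃ u : L.lattice → ℝ, Summable u ∧
      ∀ᶠ l : L.lattice in cofinite, ∀ z, ‖z‖ ≤ R → ‖sigmaFactor l z - 1‖ ≤ u l := by
  -- The sum of |l|⁻³ converges because the lattice has rank 2 < 3. The estimate holds for |l| >
  -- |R|, which excludes only finitely many points, among them l = 0.
  refine ⟨fun l ↦ Real.exp (3 / 2) * |R| ^ 3 * (‖l‖ ^ 3)⁻¹, ?_, ?_⟩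
  · exact by
      simpa using (ZLattice.summable_norm_pow_inv (L := L.lattice) 3 (by simp)).mul_left
        (Real.exp (3 / 2) * |R| ^ 3)
  · refine (isCompact_iff_finite.mp (isCompact_closedBall (0 : L.lattice) |R|)).subset ?_
    intro l hl
    by_contra hlR
    simp only [Metric.mem_closedBall, dist_zero_right, not_le] at hlR
    refine hl fun z hz ↦ ?_
    have hl0 : 0 < ‖(l : ℂ)‖ := (abs_nonneg R).trans_lt hlR
    have hz' : ‖z‖ ≤ |R| := hz.trans (le_abs_self R)
    have h1 : ‖z / l‖ ≤ 1 := by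
      rw [norm_div, div_le_one hl0]
      exact hz'.trans hlR.le
    have h2 : sigmaFactor l z = (1 - z / l) * exp (z / l + (z / l) ^ 2 / 2) := by
      unfold sigmaFactor
      congr 3
      rw [div_pow, div_div, mul_comm]
    rw [h2]
    refine (norm_primaryFactor_sub_one_le h1).trans ?_
    rw [norm_div, div_pow, div_eq_mul_inv (‖z‖ ^ 3), ← mul_assoc]
    change _ ≤ Real.exp (3 / 2) * |R| ^ 3 * (‖(l : ℂ)‖ ^ 3)⁻¹
    gcongr

lemma tendstoLocallyUniformlyOn_sigmaProd (L : PeriodPair) :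
    TendstoLocallyUniformlyOn (fun (s : Finset L.lattice) z ↦ ∏ l ∈ s, sigmaFactor l z)
      (sigmaProd L) atTop Set.univ := by
  have := tendstoLocallyUniformlyOn_prod_one_add (f := fun (l : L.lattice) z ↦ sigmaFactor l z - 1)
    (fun l ↦ (differentiable_sigmaFactor l).sub_const 1) (exists_sigmaFactor_bound L)
  simpa only [add_sub_cancel] using! this

@[fun_prop]
lemma differentiable_sigmaProd (L : PeriodPair) : Differentiable ℂ (sigmaProd L) := by
  have := differentiable_tprod_one_add (f := fun (l : L.lattice) z ↦ sigmaFactor l z - 1)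
    (fun l ↦ (differentiable_sigmaFactor l).sub_const 1) (exists_sigmaFactor_bound L)
  simpa only [add_sub_cancel] using! this

@[fun_prop]
lemma differentiable_sigma (L : PeriodPair) : Differentiable ℂ (sigma L) :=
  differentiable_id.mul (differentiable_sigmaProd L)

lemma sigmaProd_ne_zero (L : PeriodPair) {z : ℂ} (hz : z ∉ L.lattice) : sigmaProd L z ≠ 0 := by
  have := tprod_one_add_ne_zero_of_summable (f := fun l : L.lattice ↦ sigmaFactor l z - 1)
    (fun l ↦ by
      rw [add_sub_cancel]
      exact sigmaFactor_ne_zero fun _ h ↦ hz (h ▸ l.2))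
    (summable_norm_of_eventually_le (exists_sigmaFactor_bound L) z)
  simpa only [add_sub_cancel] using! this

lemma ne_zero_of_notMem {L : PeriodPair} {z : ℂ} (hz : z ∉ L.lattice) : z ≠ 0 :=
  fun h ↦ hz (h ▸ zero_mem _)

lemma sigma_ne_zero (L : PeriodPair) {z : ℂ} (hz : z ∉ L.lattice) : sigma L z ≠ 0 := by
  rw [sigma_eq]
  exact mul_ne_zero (ne_zero_of_notMem hz) (sigmaProd_ne_zero L hz)

lemma sigma_zero (L : PeriodPair) : sigma L 0 = 0 := by simp [sigma_eq]

lemma sigma_neg (L : PeriodPair) (z : ℂ) : sigma L (-z) = -sigma L z := by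
  have : sigmaProd L (-z) = sigmaProd L z := by
    unfold sigmaProd
    rw [← (Equiv.neg L.lattice).tprod_eq]
    refine tprod_congr fun l ↦ ?_
    simp [sigmaFactor]
  rw [sigma_eq, sigma_eq, this, neg_mul]

/-- The right side is minus the summand of the series for `weierstrassPExcept 0`; the factor z of σ
later supplies the missing term 1/z². -/
lemma deriv_logDeriv_sigmaFactor {l z : ℂ} (h : z ≠ l) :
    deriv (logDeriv (sigmaFactor l)) z = -(if l = 0 then 0 else 1 / (z - l) ^ 2 - 1 / l ^ 2) := by
  split_ifs with hl
  · subst hl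
    have : sigmaFactor 0 = fun _ ↦ 1 := funext sigmaFactor_zero_left
    rw [this, logDeriv_const]
    simp
  · have hlog : ∀ᶠ y in 𝓝 z, logDeriv (sigmaFactor l) y = 1 / (y - l) + 1 / l + y / l ^ 2 := by
      filter_upwards [isOpen_ne.mem_nhds h] with y (hy : y ≠ l)
      have hd1 : HasDerivAt (fun y : ℂ ↦ 1 - y / l) (-(1 / l)) y := by
        simpa using ((hasDerivAt_id y).div_const l).const_sub 1
      have hd2 : HasDerivAt (fun y : ℂ ↦ y / l + y ^ 2 / (2 * l ^ 2)) (1 / l + y / l ^ 2) y := by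
        have := ((hasDerivAt_id y).div_const l).add
          (((hasDerivAt_id y).pow 2).div_const (2 * l ^ 2))
        convert! this using 1
        simp
        field_simp
      have hd : HasDerivAt (sigmaFactor l) _ y := hd1.mul hd2.cexp
      have h1 : y - l ≠ 0 := sub_ne_zero.mpr hy
      have h2 : l - y ≠ 0 := sub_ne_zero.mpr hy.symm
      rw [logDeriv_apply, hd.deriv, sigmaFactor]
      have h3 : 1 - y / l = -(y - l) / l := by field_simp; ring
      rw [h3]
      have := exp_ne_zero (y / l + y ^ 2 / (2 * l ^ 2))
      generalize exp (y / l + y ^ 2 / (2 * l ^ 2)) = E at *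
      field_simp
      ring
    rw [EventuallyEq.deriv_eq hlog]
    have h1 : z - l ≠ 0 := sub_ne_zero.mpr h
    have hd := ((((hasDerivAt_id z).sub_const l).inv h1).add_const (1 / l)).add
      ((hasDerivAt_id z).div_const (l ^ 2))
    have : HasDerivAt (fun y : ℂ ↦ 1 / (y - l) + 1 / l + y / l ^ 2)
        (-1 / (z - l) ^ 2 + 1 / l ^ 2) z := by
      convert! hd using 1
      ext y
      simp
    rw [this.deriv]
    ring

lemma deriv_logDeriv_prod {ι : Type*} (s : Finset ι) {f : ι → ℂ → ℂ} {z : ℂ}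
    (hf : ∀ i, Differentiable ℂ (f i)) (hz : ∀ i, f i z ≠ 0) :
    deriv (logDeriv fun z ↦ ∏ i ∈ s, f i z) z = ∑ i ∈ s, deriv (logDeriv (f i)) z := by
  have h : ∀ᶠ y in 𝓝 z, logDeriv (fun z ↦ ∏ i ∈ s, f i z) y = ∑ i ∈ s, logDeriv (f i) y := by
    have : ∀ᶠ y in 𝓝 z, ∀ i ∈ s, f i y ≠ 0 :=
      (Finset.eventually_all s).mpr fun i _ ↦ (hf i).continuous.continuousAt.eventually_ne (hz i)
    filter_upwards [this] with y hy
    exact logDeriv_prod hy fun i _ ↦ hf i y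
  rw [EventuallyEq.deriv_eq h, deriv_fun_sum]
  intro i _
  exact (differentiable_deriv (hf i) z).div (hf i z) (hz i)

lemma deriv_logDeriv_sigmaProd (L : PeriodPair) {z : ℂ} (hz : z ∉ L.lattice) :
    deriv (logDeriv (sigmaProd L)) z = -L.weierstrassPExcept 0 z := by
  have h1 := tendsto_deriv_logDeriv (tendstoLocallyUniformlyOn_sigmaProd L)
    (fun s ↦ Differentiable.fun_finsetProd fun i _ ↦ differentiable_sigmaFactor i)
    (differentiable_sigmaProd L) (sigmaProd_ne_zero L hz)
  have h2 : Tendsto _ atTop _ := (L.hasSum_weierstrassPExcept 0 z).neg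
  refine tendsto_nhds_unique h1 (h2.congr fun s ↦ ?_)
  have hne (l : L.lattice) : z ≠ l := fun h ↦ hz (h ▸ l.2)
  rw [deriv_logDeriv_prod s (fun l : L.lattice ↦ differentiable_sigmaFactor l)
    fun l ↦ sigmaFactor_ne_zero fun _ ↦ hne l]
  exact (Finset.sum_congr rfl fun l _ ↦ deriv_logDeriv_sigmaFactor (hne l)).symm

lemma deriv_logDeriv_mul {f g : ℂ → ℂ} {z : ℂ} (hf : Differentiable ℂ f) (hg : Differentiable ℂ g)
    (hfz : f z ≠ 0) (hgz : g z ≠ 0) :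
    deriv (logDeriv fun z ↦ f z * g z) z = deriv (logDeriv f) z + deriv (logDeriv g) z := by
  have h : ∀ᶠ y in 𝓝 z, logDeriv (fun z ↦ f z * g z) y = logDeriv f y + logDeriv g y := by
    filter_upwards [hf.continuous.continuousAt.eventually_ne hfz,
      hg.continuous.continuousAt.eventually_ne hgz] with y h1 h2
    exact logDeriv_mul y h1 h2 (hf y) (hg y)
  rw [EventuallyEq.deriv_eq h, deriv_fun_add]
  · exact (differentiable_deriv hf z).div (hf z) hfz
  · exact (differentiable_deriv hg z).div (hg z) hgz

lemma deriv_logDeriv_id (z : ℂ) : deriv (logDeriv fun z : ℂ ↦ z) z = -(1 / z ^ 2) := by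
  have : logDeriv (fun z : ℂ ↦ z) = fun z ↦ z⁻¹ := by
    ext z
    simp
  rw [this]
  simp

lemma deriv_logDeriv_sigma (L : PeriodPair) {z : ℂ} (hz : z ∉ L.lattice) :
    deriv (logDeriv (sigma L)) z = -L.weierstrassP z := by
  have : sigma L = fun z ↦ z * sigmaProd L z := rfl
  rw [this, deriv_logDeriv_mul differentiable_fun_id (differentiable_sigmaProd L)
    (ne_zero_of_notMem hz) (sigmaProd_ne_zero L hz), deriv_logDeriv_id,
    deriv_logDeriv_sigmaProd L hz, ← L.weierstrassPExcept_add 0 z]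
  simp

/-! ### Liouville's theorem for elliptic functions -/

/-- The complement of the lattice is stable under lattice translations, so the periods valid on it
form a subgroup. -/
lemma periodic_of_generators (L : PeriodPair) {f : ℂ → ℂ}
    (h₁ : ∀ z ∉ L.lattice, f (z + L.ω₁) = f z) (h₂ : ∀ z ∉ L.lattice, f (z + L.ω₂) = f z)
    {l : ℂ} (hl : l ∈ L.lattice) : ∀ z ∉ L.lattice, f (z + l) = f z := by
  let S : AddSubgroup ℂ :=
    { carrier := {l | l ∈ L.lattice ∧ ∀ z ∉ L.lattice, f (z + l) = f z}
      zero_mem' := ⟨zero_mem _, by simp⟩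
      add_mem' := by
        rintro a b ⟨ha, ha'⟩ ⟨hb, hb'⟩
        refine ⟨add_mem ha hb, fun z hz ↦ ?_⟩
        rw [← add_assoc, hb' _ (fun h ↦ hz ((add_mem_cancel_right ha).mp h)), ha' z hz]
      neg_mem' := by
        rintro a ⟨ha, ha'⟩
        refine ⟨neg_mem ha, fun z hz ↦ ?_⟩
        have := ha' (z + -a) (fun h ↦ hz ((add_mem_cancel_right (neg_mem ha)).mp h))
        rw [← this, neg_add_cancel_right] }
  have hS : L.lattice ≤ AddSubgroup.toIntSubmodule S := by
    rw [PeriodPair.lattice, Submodule.span_le]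
    rintro x (rfl | rfl)
    · exact ⟨L.ω₁_mem_lattice, h₁⟩
    · exact ⟨L.ω₂_mem_lattice, h₂⟩
  exact (hS hl).2

/-- An elliptic function with singularities only at the lattice points, where they are removable,
is constant. -/
lemma eq_const_of_periodic (L : PeriodPair) {f g : ℂ → ℂ}
    (hf : DifferentiableOn ℂ f (L.lattice : Set ℂ)ᶜ)
    (h₁ : ∀ z ∉ L.lattice, f (z + L.ω₁) = f z) (h₂ : ∀ z ∉ L.lattice, f (z + L.ω₂) = f z)
    (hg : AnalyticAt ℂ g 0) (hfg : f =ᶠ[𝓝[≠] 0] g) {z : ℂ} (hz : z ∉ L.lattice) :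
    f z = g 0 := by
  classical
  -- The values of f at lattice points carry no meaning (quotients by zero in the applications), so
  -- they are replaced by the removable value.
  let F : ℂ → ℂ := fun z ↦ if z ∈ L.lattice then g 0 else f z
  have hper (z l : ℂ) (hl : l ∈ L.lattice) : F (z + l) = F z := by
    by_cases hz : z ∈ L.lattice
    · simp [F, hz, add_mem hz hl]
    · have : z + l ∉ L.lattice := fun h ↦ hz ((add_mem_cancel_right hl).mp h)
      simp only [F, hz, this, if_false]
      exact periodic_of_generators L h₁ h₂ hl z hz
  have hF0 : F =ᶠ[𝓝 0] g := by
    have h0 := L.compl_lattice_sdiff_singleton_mem_nhds 0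
    filter_upwards [h0, eventually_nhdsWithin_iff.mp hfg] with y hy hfy
    rcases eq_or_ne y 0 with rfl | hy0
    · simp [F]
    · have : y ∉ L.lattice := fun h ↦ hy ⟨h, hy0⟩
      simpa [F, this] using hfy hy0
  have hF : Differentiable ℂ F := by
    intro y
    by_cases hy : y ∈ L.lattice
    · have h1 : DifferentiableAt ℂ F (y - y) := by
        rw [sub_self]
        exact (hg.congr hF0.symm).differentiableAt
      -- Periodicity carries differentiability from 0 to the lattice point y.
      have h2 : F = fun x ↦ F (x - y) := by
        ext x
        rw [sub_eq_add_neg, hper _ _ (neg_mem hy)]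
      rw [h2]
      exact DifferentiableAt.comp (g := F) (f := fun x ↦ x - y) y h1 (by fun_prop)
    · have hop : (L.lattice : Set ℂ)ᶜ ∈ 𝓝 y := L.isClosed_lattice.isOpen_compl.mem_nhds hy
      refine ((hf y hy).differentiableAt hop).congr_of_eventuallyEq ?_
      filter_upwards [hop] with x hx
      exact if_neg hx
  have hb := (IsZLattice.isCompact_range_of_periodic L.lattice F hF.continuous hper).isBounded
  have := hF.apply_eq_apply_of_bounded hb z 0
  simpa [F, hz] using this

lemma countable_lattice (L : PeriodPair) : (L.lattice : Set ℂ).Countable :=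
  Set.countable_coe_iff.mp (inferInstanceAs (Countable L.lattice))

lemma dense_compl_lattice (L : PeriodPair) : Dense (L.lattice : Set ℂ)ᶜ :=
  (countable_lattice L).dense_compl ℂ

lemma isPreconnected_compl_lattice (L : PeriodPair) : IsPreconnected (L.lattice : Set ℂ)ᶜ :=
  ((countable_lattice L).isConnected_compl_of_one_lt_rank (by simp)).isPreconnected

lemma differentiable_dslope_zero {f : ℂ → ℂ} (hf : Differentiable ℂ f) :
    Differentiable ℂ (dslope f 0) := by
  rw [← differentiableOn_univ] at hf ⊢
  exact (Complex.differentiableOn_dslope univ_mem).mpr hf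

lemma eq_mul_dslope_zero {f : ℂ → ℂ} (hf : f 0 = 0) (z : ℂ) : f z = z * dslope f 0 z := by
  have := sub_smul_dslope f 0 z
  simpa [hf] using this.symm

/-! ### The product `∏ₙ (1 - qⁿ w)` -/

/-- The infinite product `∏_{n ≥ 0} (1 - qⁿ w)`. -/
def qProd (q w : ℂ) : ℂ := ∏' n : ℕ, (1 + -(q ^ n * w))

section

variable {q : ℂ} (hq : ‖q‖ < 1)
include hq

lemma exists_qProd_bound (R : ℝ) : ∃ u : ℕ → ℝ, Summable u ∧
    ∀ᶠ n in cofinite, ∀ w : ℂ, ‖w‖ ≤ R → ‖-(q ^ n * w)‖ ≤ u n := by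
  refine ⟨fun n ↦ ‖q‖ ^ n * R, (summable_geometric_of_lt_one (norm_nonneg q) hq).mul_right R,
    .of_forall fun n w hw ↦ ?_⟩
  rw [norm_neg, norm_mul, norm_pow]
  exact mul_le_mul_of_nonneg_left hw (by positivity)

lemma differentiable_qProd : Differentiable ℂ (qProd q) :=
  differentiable_tprod_one_add (fun n ↦ by fun_prop) (exists_qProd_bound hq)

lemma qProd_ne_zero {w : ℂ} (h : ∀ n : ℕ, q ^ n * w ≠ 1) : qProd q w ≠ 0 := by
  refine tprod_one_add_ne_zero_of_summable (fun n h0 ↦ h n ?_)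
    (summable_norm_of_eventually_le (exists_qProd_bound hq) w)
  linear_combination -h0

lemma qProd_eq_one_sub_mul (w : ℂ) : qProd q w = (1 - w) * qProd q (q * w) := by
  have hm : Multipliable fun n : ℕ ↦ 1 + -(q ^ (n + 1) * w) := by
    have := multipliable_one_add_of_summable
      (summable_norm_of_eventually_le (exists_qProd_bound hq) (q * w))
    simpa only [pow_succ, mul_assoc] using this
  unfold qProd
  rw [tprod_eq_zero_mul' (f := fun n : ℕ ↦ 1 + -(q ^ n * w)) hm]
  simp only [pow_succ, pow_zero, one_mul, mul_assoc, sub_eq_add_neg]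

end

/-! ### The product expansion of the theta function -/

/-- The exponential `e^{2πiz}`. -/
def cis (z : ℂ) : ℂ := exp (2 * Real.pi * I * z)

lemma cis_add (z w : ℂ) : cis (z + w) = cis z * cis w := by
  rw [cis, mul_add, exp_add, cis, cis]

lemma cis_nat_mul (n : ℕ) (z : ℂ) : cis (n * z) = cis z ^ n := by
  rw [cis, cis, ← exp_nat_mul]
  ring_nf

lemma cis_one : cis 1 = 1 := by simp [cis, exp_two_pi_mul_I]

lemma cis_neg_one : cis (-1) = 1 := by simp [cis, exp_neg, exp_two_pi_mul_I]

lemma cis_neg (z : ℂ) : cis (-z) = (cis z)⁻¹ := by simp [cis, exp_neg]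

lemma cis_eq_one_iff {z : ℂ} : cis z = 1 ↔ ∃ n : ℤ, z = n := by
  have h : (2 * Real.pi * I : ℂ) ≠ 0 := two_pi_I_ne_zero
  rw [cis, exp_eq_one_iff]
  refine exists_congr fun n ↦ ?_
  rw [mul_comm (n : ℂ), mul_right_inj' h]

@[fun_prop]
lemma differentiable_cis : Differentiable ℂ cis := by
  unfold cis
  fun_prop

lemma norm_cis_lt_one {τ : ℂ} (hτ : 0 < τ.im) : ‖cis τ‖ < 1 := by
  rw [cis, norm_exp, Real.exp_lt_one_iff]
  have : (2 * Real.pi * I * τ : ℂ).re = -(2 * Real.pi * τ.im) := by simp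
  rw [this]
  have := Real.pi_pos
  have : 0 < 2 * Real.pi * τ.im := by positivity
  linarith

/-- The product `sin (πz) ∏_{n ≥ 1} (1 - qⁿ e^{2πiz}) (1 - qⁿ e^{-2πiz})` with `q = e^{2πiτ}`. -/
def thetaProd (τ z : ℂ) : ℂ :=
  sin (Real.pi * z) * (qProd (cis τ) (cis τ * cis z) * qProd (cis τ) (cis τ * cis (-z)))

lemma thetaProd_zero (τ : ℂ) : thetaProd τ 0 = 0 := by simp [thetaProd]

lemma thetaProd_neg (τ z : ℂ) : thetaProd τ (-z) = -thetaProd τ z := by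
  simp only [thetaProd, mul_neg, sin_neg, neg_neg]
  ring

lemma thetaProd_add_one (τ z : ℂ) : thetaProd τ (z + 1) = -thetaProd τ z := by
  simp only [thetaProd, mul_add, mul_one, sin_add_pi, neg_add, cis_add, cis_one, cis_neg_one]
  ring

section

variable {τ : ℂ} (hτ : 0 < τ.im)
include hτ

lemma differentiable_thetaProd : Differentiable ℂ (thetaProd τ) := by
  have h := differentiable_qProd (norm_cis_lt_one hτ)
  unfold thetaProd
  fun_prop

lemma thetaProd_ne_zero {z : ℂ} (hz : ∀ m n : ℤ, z ≠ m + n * τ) : thetaProd τ z ≠ 0 := by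
  refine mul_ne_zero (fun h ↦ ?_) (mul_ne_zero ?_ ?_)
  · obtain ⟨k, hk⟩ := sin_eq_zero_iff.mp h
    have : (Real.pi : ℂ) ≠ 0 := by exact_mod_cast Real.pi_ne_zero
    refine hz k 0 ?_
    rw [mul_comm, mul_left_inj' this] at hk
    simpa using hk
  · refine qProd_ne_zero (norm_cis_lt_one hτ) fun n h ↦ ?_
    rw [← cis_nat_mul, ← cis_add, ← cis_add, cis_eq_one_iff] at h
    obtain ⟨k, hk⟩ := h
    refine hz k (-(n + 1)) ?_
    push_cast
    linear_combination hk
  · refine qProd_ne_zero (norm_cis_lt_one hτ) fun n h ↦ ?_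
    rw [← cis_nat_mul, ← cis_add, ← cis_add, cis_eq_one_iff] at h
    obtain ⟨k, hk⟩ := h
    refine hz (-k) (n + 1) ?_
    push_cast
    linear_combination -hk

/-- The derivative is π times the square of ∏ (1 - qⁿ), n ≥ 1. The zero at 0 is thus simple, which
makes the singularities in both Liouville arguments removable. -/
lemma deriv_thetaProd_zero_ne_zero : deriv (thetaProd τ) 0 ≠ 0 := by
  have hq := norm_cis_lt_one hτ
  have h := differentiable_qProd hq
  have hB : Differentiable ℂ fun z ↦
      qProd (cis τ) (cis τ * cis z) * qProd (cis τ) (cis τ * cis (-z)) := by fun_prop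
  have hs : HasDerivAt (fun z : ℂ ↦ sin (Real.pi * z)) (Real.pi : ℂ) 0 := by
    have := ((hasDerivAt_id (0 : ℂ)).const_mul (Real.pi : ℂ)).csin
    simpa using this
  have hd : HasDerivAt (thetaProd τ) _ 0 := hs.mul (hB 0).hasDerivAt
  rw [hd.deriv]
  have hne : qProd (cis τ) (cis τ) ≠ 0 := by
    refine qProd_ne_zero hq fun n h ↦ ?_
    have := congrArg norm h
    rw [← pow_succ, norm_pow, norm_one] at this
    exact (pow_lt_one₀ (norm_nonneg _) hq n.succ_ne_zero).ne this
  have hc : cis 0 = 1 := by simp [cis]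
  simp [hc, hne, Real.pi_ne_zero]

lemma thetaProd_add_tau (z : ℂ) :
    thetaProd τ (z + τ) = -exp (-(Real.pi * I * (2 * z + τ))) * thetaProd τ z := by
  have hq := norm_cis_lt_one hτ
  have h1 := qProd_eq_one_sub_mul hq (cis τ * cis z)
  have h2 := qProd_eq_one_sub_mul hq (cis (-z))
  have h3 : cis τ * cis (-(z + τ)) = cis (-z) := by
    rw [← cis_add]
    congr 1
    ring
  have h4 : cis τ * cis (z + τ) = cis τ * (cis τ * cis z) := by rw [cis_add, mul_comm (cis z)]
  rw [thetaProd, thetaProd, h3, h4, h1, h2]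
  generalize qProd (cis τ) (cis τ * (cis τ * cis z)) = X
  generalize qProd (cis τ) (cis τ * cis (-z)) = Y
  -- The translation by τ shifts the index in both products, so one loses a factor and the other
  -- gains one. What remains is this identity, rational in e^{πiz} and e^{πiτ}.
  have key : sin (Real.pi * (z + τ)) * (1 - cis (-z)) =
      -exp (-(Real.pi * I * (2 * z + τ))) * (sin (Real.pi * z) * (1 - cis τ * cis z)) := by
    have ha : exp (Real.pi * I * z) ≠ 0 := exp_ne_zero _
    have hb : exp (Real.pi * I * τ) ≠ 0 := exp_ne_zero _
    have e1 : cis z = exp (Real.pi * I * z) ^ 2 := by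
      rw [cis, ← exp_nat_mul]
      push_cast
      ring_nf
    have e2 : cis τ = exp (Real.pi * I * τ) ^ 2 := by
      rw [cis, ← exp_nat_mul]
      push_cast
      ring_nf
    have e3 : exp (-(Real.pi * I * (2 * z + τ))) =
        (exp (Real.pi * I * z) ^ 2 * exp (Real.pi * I * τ))⁻¹ := by
      rw [← exp_nat_mul, ← exp_add, ← exp_neg]
      push_cast
      ring_nf
    have e4 : sin (Real.pi * z) = ((exp (Real.pi * I * z))⁻¹ - exp (Real.pi * I * z)) * I / 2 := by
      rw [Complex.sin, ← exp_neg]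
      ring_nf
    have e5 : sin (Real.pi * (z + τ)) = ((exp (Real.pi * I * z) * exp (Real.pi * I * τ))⁻¹ -
        exp (Real.pi * I * z) * exp (Real.pi * I * τ)) * I / 2 := by
      rw [Complex.sin, ← exp_add, ← exp_neg]
      ring_nf
    rw [cis_neg, e1, e2, e3, e4, e5]
    generalize exp (Real.pi * I * z) = a at *
    generalize exp (Real.pi * I * τ) = b at *
    field_simp
    ring
  linear_combination X * Y * key

end

/-! ### The theta function -/

lemma theta1_eq (τ z : ℂ) : theta1 τ z =
    exp (Real.pi * I * (z + 1 / 2 + τ / 4)) * jacobiTheta₂ (z + (1 + τ) / 2) τ := by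
  rw [theta1, jacobiTheta₂, ← tsum_mul_left]
  refine tsum_congr fun k ↦ ?_
  rw [jacobiTheta₂_term, ← exp_add]
  ring_nf

lemma theta1_add_one (τ z : ℂ) : theta1 τ (z + 1) = -theta1 τ z := by
  have h : z + 1 + (1 + τ) / 2 = z + (1 + τ) / 2 + 1 := by ring
  have e : (Real.pi * I * (z + 1 + 1 / 2 + τ / 4) : ℂ) =
    Real.pi * I * (z + 1 / 2 + τ / 4) + Real.pi * I := by ring
  rw [theta1_eq, theta1_eq, h, jacobiTheta₂_add_left, e, exp_add, exp_pi_mul_I]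
  ring

lemma theta1_add_tau (τ z : ℂ) :
    theta1 τ (z + τ) = -exp (-(Real.pi * I * (2 * z + τ))) * theta1 τ z := by
  have h : z + τ + (1 + τ) / 2 = z + (1 + τ) / 2 + τ := by ring
  rw [theta1_eq, theta1_eq, h, jacobiTheta₂_add_left', ← mul_assoc, ← mul_assoc, ← exp_add]
  congr 1
  have hm : exp (-(Real.pi * I)) = -1 := by rw [exp_neg, exp_pi_mul_I]; norm_num
  rw [← neg_one_mul (exp (-(Real.pi * I * (2 * z + τ)))), ← hm, ← exp_add, ← exp_add]
  ring_nf

/-- The points ±(1 + τ)/2 differ by the period 1 + τ, whose multiplier there is e^{-πi} = -1,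
whereas `jacobiTheta₂` is even. -/
lemma theta1_zero (τ : ℂ) : theta1 τ 0 = 0 := by
  have h1 : jacobiTheta₂ ((1 + τ) / 2) τ = jacobiTheta₂ (-((1 + τ) / 2)) τ :=
    (jacobiTheta₂_neg_left _ _).symm
  have h2 : jacobiTheta₂ ((1 + τ) / 2) τ = -jacobiTheta₂ (-((1 + τ) / 2)) τ := by
    have h3 : (1 + τ) / 2 = -((1 + τ) / 2) + 1 + τ := by ring
    conv_lhs => rw [h3, jacobiTheta₂_add_left', jacobiTheta₂_add_left]
    have : (-Real.pi * I * (τ + 2 * (-((1 + τ) / 2) + 1)) : ℂ) = -(Real.pi * I) := by ring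
    rw [this, exp_neg, exp_pi_mul_I]
    norm_num
  rw [theta1_eq, zero_add, zero_add]
  have : jacobiTheta₂ ((1 + τ) / 2) τ = 0 := by linear_combination (h1 + h2) / 2
  rw [this, mul_zero]

section

variable {τ : ℂ} (hτ : 0 < τ.im)
include hτ

lemma differentiable_theta1 : Differentiable ℂ (theta1 τ) := by
  have h : theta1 τ = fun z ↦ exp (Real.pi * I * (z + 1 / 2 + τ / 4)) *
      jacobiTheta₂ (z + (1 + τ) / 2) τ := funext (theta1_eq τ)
  have hj : Differentiable ℂ fun z ↦ jacobiTheta₂ z τ :=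
    fun z ↦ differentiableAt_jacobiTheta₂_fst z hτ
  have hj' : Differentiable ℂ fun z ↦ jacobiTheta₂ (z + (1 + τ) / 2) τ :=
    hj.comp (differentiable_id.add_const ((1 + τ) / 2))
  rw [h]
  fun_prop

/-- The constant Fourier coefficient of `θ` equals `1`. -/
lemma integral_jacobiTheta₂ : ∫ x in (0 : ℝ)..1, jacobiTheta₂ x τ = 1 := by
  have hcont (n : ℤ) : Continuous fun x : ℝ ↦ jacobiTheta₂_term n x τ := by
    unfold jacobiTheta₂_term
    fun_prop
  -- On the real line the norm of a term does not depend on x, so the series may be integrated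
  -- termwise.
  have hnorm (n : ℤ) (x : ℝ) : ‖jacobiTheta₂_term n x τ‖ = ‖jacobiTheta₂_term n 0 τ‖ := by
    simp [norm_jacobiTheta₂_term]
  have hsum : Summable fun n : ℤ ↦
      ‖(⟨fun x : ℝ ↦ jacobiTheta₂_term n x τ, hcont n⟩ : C(ℝ, ℂ)).restrict
        (⟨Set.uIcc (0 : ℝ) 1, isCompact_uIcc⟩ : TopologicalSpace.Compacts ℝ)‖ := by
    refine Summable.of_nonneg_of_le (fun n ↦ norm_nonneg _) (fun n ↦ ?_)
      ((summable_jacobiTheta₂_term_iff 0 τ).mpr hτ).norm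
    refine (ContinuousMap.norm_le _ (norm_nonneg _)).mpr fun x ↦ ?_
    exact (hnorm n x).le
  have h := intervalIntegral.hasSum_intervalIntegral_of_summable_norm hsum
  have hterm (n : ℤ) : ∫ x in (0 : ℝ)..1, jacobiTheta₂_term n x τ = if n = 0 then 1 else 0 := by
    split_ifs with hn
    · simp [hn, jacobiTheta₂_term]
    · have hc : (2 * Real.pi * I * n : ℂ) ≠ 0 :=
        mul_ne_zero two_pi_I_ne_zero (Int.cast_ne_zero.mpr hn)
      have : (fun x : ℝ ↦ jacobiTheta₂_term n x τ) =
          fun x : ℝ ↦ exp (2 * Real.pi * I * n * x) * exp (Real.pi * I * n ^ 2 * τ) := by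
        ext x
        rw [jacobiTheta₂_term, exp_add]
      rw [this, intervalIntegral.integral_mul_const, integral_exp_mul_complex hc]
      have : exp (2 * Real.pi * I * n) = 1 := by
        rw [mul_comm]
        exact exp_int_mul_two_pi_mul_I n
      simp [this]
  refine HasSum.unique (f := fun n : ℤ ↦ if n = 0 then (1 : ℂ) else 0) ?_ (hasSum_ite_eq 0 1)
  simpa only [ContinuousMap.coe_mk, hterm] using! h

lemma exists_theta1_ne_zero : ∃ z, theta1 τ z ≠ 0 := by
  by_contra! h
  have h0 (z : ℂ) : jacobiTheta₂ z τ = 0 := by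
    have := h (z - (1 + τ) / 2)
    rw [theta1_eq, sub_add_cancel] at this
    exact (mul_eq_zero.mp this).resolve_left (exp_ne_zero _)
  have := integral_jacobiTheta₂ hτ
  simp [h0] at this

end

/-! ### Theta functions on a period lattice -/

lemma ω₁_ne_zero (L : PeriodPair) : L.ω₁ ≠ 0 := by simpa using L.indep.ne_zero 0

/-- The ratio of the periods. -/
def ratio (L : PeriodPair) : ℂ := L.ω₂ / L.ω₁

lemma ratio_eq (L : PeriodPair) : halfω₂ L / halfω₁ L = ratio L := by
  have := ω₁_ne_zero L
  rw [halfω₁, halfω₂, ratio]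
  field_simp

lemma add_ω₁_div (L : PeriodPair) (z : ℂ) : (z + L.ω₁) / L.ω₁ = z / L.ω₁ + 1 := by
  rw [add_div, div_self (ω₁_ne_zero L)]

lemma add_ω₂_div (L : PeriodPair) (z : ℂ) : (z + L.ω₂) / L.ω₁ = z / L.ω₁ + ratio L := by
  rw [add_div, ratio]

/-- The product expansion of the theta function, rescaled to the periods of `L`. -/
def latticeProd (L : PeriodPair) (z : ℂ) : ℂ := thetaProd (ratio L) (z / L.ω₁)

lemma latticeProd_zero (L : PeriodPair) : latticeProd L 0 = 0 := by
  rw [latticeProd, zero_div, thetaProd_zero]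

lemma latticeProd_neg (L : PeriodPair) (z : ℂ) : latticeProd L (-z) = -latticeProd L z := by
  rw [latticeProd, neg_div, thetaProd_neg, latticeProd]

lemma latticeProd_add_ω₁ (L : PeriodPair) (z : ℂ) :
    latticeProd L (z + L.ω₁) = -latticeProd L z := by
  rw [latticeProd, add_ω₁_div, thetaProd_add_one, latticeProd]

section

variable {L : PeriodPair} (hL : 0 < (ratio L).im)
include hL

lemma latticeProd_add_ω₂ (z : ℂ) : latticeProd L (z + L.ω₂) =
    -exp (-(Real.pi * I * (2 * (z / L.ω₁) + ratio L))) * latticeProd L z := by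
  rw [latticeProd, add_ω₂_div, thetaProd_add_tau hL, latticeProd]

lemma differentiable_latticeProd : Differentiable ℂ (latticeProd L) := by
  have := differentiable_thetaProd hL
  unfold latticeProd
  fun_prop

lemma latticeProd_ne_zero {z : ℂ} (hz : z ∉ L.lattice) : latticeProd L z ≠ 0 := by
  refine thetaProd_ne_zero hL fun m n h ↦ hz (PeriodPair.mem_lattice.mpr ⟨m, n, ?_⟩)
  rw [ratio, div_eq_iff (ω₁_ne_zero L)] at h
  rw [h]
  have := ω₁_ne_zero L
  field_simp

lemma dslope_latticeProd_ne_zero : dslope (latticeProd L) 0 0 ≠ 0 := by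
  have hd : HasDerivAt (latticeProd L) (deriv (thetaProd (ratio L)) 0 * (1 / L.ω₁)) 0 := by
    have h1 : HasDerivAt (fun z : ℂ ↦ z / L.ω₁) (1 / L.ω₁) 0 :=
      (hasDerivAt_id (0 : ℂ)).div_const L.ω₁
    have h2 : HasDerivAt (thetaProd (ratio L)) (deriv (thetaProd (ratio L)) 0) (0 / L.ω₁) := by
      rw [zero_div]
      exact (differentiable_thetaProd hL 0).hasDerivAt
    exact HasDerivAt.comp (h₂ := thetaProd (ratio L)) (h := fun z : ℂ ↦ z / L.ω₁) 0 h2 h1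
  rw [dslope_same, hd.deriv]
  exact mul_ne_zero (deriv_thetaProd_zero_ne_zero hL) (by simp [ω₁_ne_zero L])

/-- The Jacobi triple product, up to the value of the constant. -/
lemma exists_theta1_eq_mul_latticeProd :
    ∃ k : ℂ, k ≠ 0 ∧ ∀ z, theta1 (ratio L) (z / L.ω₁) = k * latticeProd L z := by
  have hθ := differentiable_theta1 hL
  have hP := differentiable_latticeProd hL
  set Θ : ℂ → ℂ := fun z ↦ theta1 (ratio L) (z / L.ω₁) with hΘ
  have hΘd : Differentiable ℂ Θ := by
    rw [hΘ]
    fun_prop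
  have hΘ0 : Θ 0 = 0 := by simp only [hΘ, zero_div, theta1_zero]
  have hdP := differentiable_dslope_zero hP
  have hP0 := dslope_latticeProd_ne_zero hL
  -- Dividing numerator and denominator by z extends Θ/P analytically through 0.
  set g : ℂ → ℂ := fun z ↦ dslope Θ 0 z / dslope (latticeProd L) 0 z
  have hgan : AnalyticAt ℂ g 0 :=
    ((differentiable_dslope_zero hΘd).analyticAt 0).div (hdP.analyticAt 0) hP0
  have hconst {z : ℂ} (hz : z ∉ L.lattice) : Θ z / latticeProd L z = g 0 := by
    refine eq_const_of_periodic L (f := fun z ↦ Θ z / latticeProd L z) ?_ ?_ ?_ hgan ?_ hz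
    · exact fun y hy ↦ ((hΘd y).div (hP y) (latticeProd_ne_zero hL hy)).differentiableWithinAt
    · intro y hy
      simp only [hΘ, latticeProd_add_ω₁, add_ω₁_div, theta1_add_one, neg_div_neg_eq]
    · intro y hy
      simp only [hΘ, latticeProd_add_ω₂ hL, add_ω₂_div, theta1_add_tau]
      exact mul_div_mul_left _ _ (neg_ne_zero.mpr (exp_ne_zero _))
    · filter_upwards [self_mem_nhdsWithin] with y (hy : y ≠ 0)
      rw [eq_mul_dslope_zero hΘ0 y, eq_mul_dslope_zero (latticeProd_zero L) y,
        mul_div_mul_left _ _ hy]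
  have heq : Θ = fun z ↦ g 0 * latticeProd L z := by
    refine hΘd.continuous.ext_on (dense_compl_lattice L) (hP.continuous.const_mul _) fun z hz ↦ ?_
    rw [← hconst hz, div_mul_cancel₀ _ (latticeProd_ne_zero hL hz)]
  refine ⟨g 0, fun h0 ↦ ?_, fun z ↦ congrFun heq z⟩
  -- A zero constant would force θ₁ to vanish identically.
  obtain ⟨u, hu⟩ := exists_theta1_ne_zero hL
  refine hu ?_
  have := congrFun heq (u * L.ω₁)
  simpa [hΘ, h0, ω₁_ne_zero L] using this

end

/-! ### The sigma function in terms of the theta function -/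

lemma logDeriv_neg_of_odd {f : ℂ → ℂ} (hf : ∀ z, f (-z) = -f z) (z : ℂ) :
    logDeriv f (-z) = -logDeriv f z := by
  have h1 : deriv (fun y ↦ f (-y)) z = -deriv f (-z) := deriv_comp_neg f z
  have h2 : (fun y ↦ f (-y)) = fun y ↦ -f y := funext hf
  rw [h2, deriv.fun_neg] at h1
  rw [logDeriv_apply, logDeriv_apply, hf, ← neg_inj.mp h1, div_neg]

lemma logDeriv_comp_add_const (f : ℂ → ℂ) (a : ℂ) :
    logDeriv (fun z ↦ f (z + a)) = fun z ↦ logDeriv f (z + a) := by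
  ext z
  rw [logDeriv_apply, logDeriv_apply, deriv_comp_add_const]

lemma logDeriv_mul_exp {c a b : ℂ} (hc : c ≠ 0) :
    logDeriv (fun z ↦ c * exp (a * z + b)) = fun _ ↦ a := by
  ext z
  have h : HasDerivAt (fun z : ℂ ↦ c * exp (a * z + b)) (c * (exp (a * z + b) * a)) z := by
    have := ((hasDerivAt_id z).const_mul a).add_const b
    rw [mul_one] at this
    exact this.cexp.const_mul c
  rw [logDeriv_apply, h.deriv]
  have := exp_ne_zero (a * z + b)
  field_simp

/-- The logarithm of the multiplier is affine, so its second derivative vanishes: quasi-periodicity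
of f becomes periodicity of (log f)''. -/
lemma deriv_logDeriv_add_of_eq_mul_exp {f : ℂ → ℂ} (hf : Differentiable ℂ f) {l a b c : ℂ}
    (hc : c ≠ 0) (h : ∀ z, f (z + l) = c * exp (a * z + b) * f z) {z : ℂ} (hz : f z ≠ 0) :
    deriv (logDeriv f) (z + l) = deriv (logDeriv f) z := by
  have h1 : deriv (logDeriv fun z ↦ f (z + l)) z = deriv (logDeriv f) (z + l) := by
    rw [logDeriv_comp_add_const, deriv_comp_add_const]
  have h2 : (fun z ↦ f (z + l)) = fun z ↦ c * exp (a * z + b) * f z := funext h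
  rw [← h1, h2, deriv_logDeriv_mul (f := fun z ↦ c * exp (a * z + b)) (by fun_prop) hf
      (mul_ne_zero hc (exp_ne_zero _)) hz,
    logDeriv_mul_exp hc, deriv_const, zero_add]

lemma halfω₁_notMem_lattice (L : PeriodPair) : halfω₁ L ∉ L.lattice :=
  L.ω₁_div_two_notMem_lattice

section

variable {L : PeriodPair} (hL : 0 < (ratio L).im)
include hL

lemma exists_deriv_logDeriv_latticeProd : ∃ c : ℂ, ∀ z ∉ L.lattice,
    deriv (logDeriv (latticeProd L)) z = c - L.weierstrassP z := by
  have hP := differentiable_latticeProd hL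
  have hD := differentiable_dslope_zero hP
  have hD0 := dslope_latticeProd_ne_zero hL
  set D := dslope (latticeProd L) 0
  -- With P = zD, the term -1/z² of (log P)'' cancels the pole of ℘ at 0; g is what remains.
  set g : ℂ → ℂ := fun z ↦ deriv (logDeriv D) z + L.weierstrassPExcept 0 z with hg
  have hgan : AnalyticAt ℂ g 0 := by
    have h1 : AnalyticAt ℂ (logDeriv D) 0 := (hD.analyticAt 0).deriv.div (hD.analyticAt 0) hD0
    exact h1.deriv.add (L.analyticAt_weierstrassPExcept 0)
  have hconst {z : ℂ} (hz : z ∉ L.lattice) :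
      deriv (logDeriv (latticeProd L)) z + L.weierstrassP z = g 0 := by
    refine eq_const_of_periodic L
      (f := fun z ↦ deriv (logDeriv (latticeProd L)) z + L.weierstrassP z) ?_ ?_ ?_ hgan ?_ hz
    · intro y hy
      have h1 : AnalyticAt ℂ (logDeriv (latticeProd L)) y :=
        (hP.analyticAt y).deriv.div (hP.analyticAt y) (latticeProd_ne_zero hL hy)
      exact (h1.deriv.add (L.analyticOnNhd_weierstrassP y hy)).differentiableAt.differentiableWithinAt
    · intro y hy
      have h1 : L.weierstrassP (y + L.ω₁) = L.weierstrassP y :=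
        L.weierstrassP_add_coe y ⟨L.ω₁, L.ω₁_mem_lattice⟩
      have h2 := deriv_logDeriv_add_of_eq_mul_exp hP (l := L.ω₁) (a := 0) (b := 0) (c := -1)
        (by simp) (fun z ↦ by simp [latticeProd_add_ω₁]) (latticeProd_ne_zero hL hy)
      simp only [h1, h2]
    · intro y hy
      have h1 : L.weierstrassP (y + L.ω₂) = L.weierstrassP y :=
        L.weierstrassP_add_coe y ⟨L.ω₂, L.ω₂_mem_lattice⟩
      have h2 := deriv_logDeriv_add_of_eq_mul_exp hP (l := L.ω₂)
        (a := -(Real.pi * I * 2 / L.ω₁)) (b := -(Real.pi * I * ratio L)) (c := -1)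
        (by simp) (fun z ↦ by
          rw [latticeProd_add_ω₂ hL, neg_one_mul]
          ring_nf) (latticeProd_ne_zero hL hy)
      simp only [h1, h2]
    · filter_upwards [self_mem_nhdsWithin,
        (hD.continuous.continuousAt.eventually_ne hD0).filter_mono nhdsWithin_le_nhds]
        with y (hy : y ≠ 0) hDy
      have h1 : latticeProd L = fun z ↦ z * D z :=
        funext (eq_mul_dslope_zero (latticeProd_zero L))
      rw [h1, deriv_logDeriv_mul differentiable_fun_id hD hy hDy, deriv_logDeriv_id,
        ← L.weierstrassPExcept_add 0 y]
      simp [hg]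
      ring
  exact ⟨g 0, fun z hz ↦ by rw [← hconst hz, add_sub_cancel_right]⟩

/-- Both second logarithmic derivatives are -℘ up to a constant c, so P'/P - σ'/σ - cz is constant
on the connected complement of the lattice, and it is zero because it is odd. -/
lemma logDeriv_latticeProd_eq {z : ℂ} (hz : z ∉ L.lattice) :
    logDeriv (latticeProd L) z = logDeriv (sigma L) z - eta1 L / halfω₁ L * z := by
  have hP := differentiable_latticeProd hL
  obtain ⟨c, hc⟩ := exists_deriv_logDeriv_latticeProd hL
  have hop : IsOpen (L.lattice : Set ℂ)ᶜ := L.isClosed_lattice.isOpen_compl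
  have hdP {y : ℂ} (hy : y ∉ L.lattice) : DifferentiableAt ℂ (logDeriv (latticeProd L)) y :=
    (differentiable_deriv hP y).div (hP y) (latticeProd_ne_zero hL hy)
  have hdS {y : ℂ} (hy : y ∉ L.lattice) : DifferentiableAt ℂ (logDeriv (sigma L)) y :=
    (differentiable_deriv (differentiable_sigma L) y).div (differentiable_sigma L y)
      (sigma_ne_zero L hy)
  set F : ℂ → ℂ := fun y ↦ logDeriv (latticeProd L) y - logDeriv (sigma L) y - c * y with hF
  have hdF {y : ℂ} (hy : y ∉ L.lattice) : HasDerivAt F 0 y := by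
    have := ((hdP hy).hasDerivAt.sub (hdS hy).hasDerivAt).sub ((hasDerivAt_id y).const_mul c)
    rw [hc y hy, deriv_logDeriv_sigma L hy] at this
    convert! this using 1
    ring
  have hh := halfω₁_notMem_lattice L
  have hnh : -halfω₁ L ∉ L.lattice := fun h ↦ hh (neg_mem_iff.mp h)
  have hconst {x y : ℂ} (hx : x ∉ L.lattice) (hy : y ∉ L.lattice) : F x = F y :=
    hop.is_const_of_deriv_eq_zero (isPreconnected_compl_lattice L)
      (fun y hy ↦ (hdF hy).differentiableAt.differentiableWithinAt) (fun y hy ↦ (hdF hy).deriv)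
      hx hy
  have hPodd := logDeriv_neg_of_odd (latticeProd_neg L)
  have hF0 : F (halfω₁ L) = 0 := by
    have h1 := hconst hnh hh
    have h2 : F (-halfω₁ L) = -F (halfω₁ L) := by
      simp only [hF, hPodd, logDeriv_neg_of_odd (sigma_neg L)]
      ring
    rw [h2] at h1
    linear_combination -h1 / 2
  -- P'/P is odd and has period 2ω₁, so it vanishes at ω₁; there σ'/σ is η₁, which determines c.
  have hPh : logDeriv (latticeProd L) (halfω₁ L) = 0 := by
    have h1 := congrFun (logDeriv_comp_add_const (latticeProd L) L.ω₁) (-halfω₁ L)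
    have h2 : (fun z ↦ latticeProd L (z + L.ω₁)) = fun z ↦ (-1 : ℂ) * latticeProd L z :=
      funext fun z ↦ by rw [latticeProd_add_ω₁, neg_one_mul]
    have h3 : -halfω₁ L + L.ω₁ = halfω₁ L := by rw [halfω₁]; ring
    simp only [h2, h3] at h1
    rw [logDeriv_const_mul _ _ (by simp), hPodd] at h1
    linear_combination -h1 / 2
  have hcval : c = -(eta1 L / halfω₁ L) := by
    have h1 : logDeriv (latticeProd L) (halfω₁ L) - eta1 L - c * halfω₁ L = 0 := hF0
    rw [hPh] at h1
    have := halfω₁_ne_zero L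
    field_simp
    linear_combination -h1
  have : F z = 0 := (hconst hz hh).trans hF0
  simp only [hF, hcval] at this
  linear_combination this

/-- `σ(z) = K e^{η₁ z² / (2 ω₁)} θ₁(z / (2 ω₁))`. -/
lemma exists_theta1_eq_mul_sigma : ∃ k : ℂ, k ≠ 0 ∧ ∀ z, theta1 (ratio L) (z / L.ω₁) =
    k * (exp (-(eta1 L / halfω₁ L * z ^ 2 / 2)) * sigma L z) := by
  have hP := differentiable_latticeProd hL
  have hS := differentiable_sigma L
  obtain ⟨k₁, hk₁, hθ⟩ := exists_theta1_eq_mul_latticeProd hL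
  set a := eta1 L / halfω₁ L
  set E : ℂ → ℂ := fun z ↦ exp (-(a * z ^ 2 / 2)) with hE
  have hEd (z : ℂ) : HasDerivAt E (E z * -(a * z)) z := by
    have h1 : HasDerivAt (fun z : ℂ ↦ -(a * z ^ 2 / 2)) (-(a * z)) z := by
      have := ((((hasDerivAt_id z).pow 2).const_mul a).div_const 2).neg
      convert! this using 1
      simp
      ring
    exact h1.cexp
  have hEne (z : ℂ) : E z ≠ 0 := exp_ne_zero _
  have hEdiff : Differentiable ℂ E := fun z ↦ (hEd z).differentiableAt
  have hlog : Set.EqOn (logDeriv (latticeProd L)) (logDeriv fun z ↦ E z * sigma L z)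
      (L.lattice : Set ℂ)ᶜ := by
    intro z hz
    rw [logDeriv_latticeProd_eq hL hz, logDeriv_mul z (hEne z) (sigma_ne_zero L hz) (hEdiff z)
      (hS z), logDeriv_apply E, (hEd z).deriv, mul_div_cancel_left₀ _ (hEne z)]
    ring
  obtain ⟨k₂, hk₂, h⟩ := (logDeriv_eqOn_iff hP.differentiableOn (hEdiff.mul hS).differentiableOn
    L.isClosed_lattice.isOpen_compl (isPreconnected_compl_lattice L)
    (fun z hz ↦ mul_ne_zero (hEne z) (sigma_ne_zero L hz))
    (fun z hz ↦ latticeProd_ne_zero hL hz)).mp hlog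
  have heq : latticeProd L = fun z ↦ k₂ * (E z * sigma L z) :=
    hP.continuous.ext_on (dense_compl_lattice L)
      (continuous_const.mul (hEdiff.continuous.mul hS.continuous)) fun z hz ↦ h hz
  refine ⟨k₁ * k₂, mul_ne_zero hk₁ hk₂, fun z ↦ ?_⟩
  rw [hθ, heq, mul_assoc]

end

/-! ### The specialization `μ_r = μ'_r = 0` -/

lemma neg_halfω₁_sub_halfω₂_notMem_lattice (L : PeriodPair) :
    -halfω₁ L - halfω₂ L ∉ L.lattice := by
  have h := (L.mul_ω₁_add_mul_ω₂_mem_lattice (α := -1 / 2) (β := -1 / 2)).not.mpr (by norm_num)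
  convert h using 2
  rw [halfω₁, halfω₂]
  push_cast
  ring

lemma differentiable_sigmaShift (L : PeriodPair) (ω : ℂ) : Differentiable ℂ (sigmaShift L ω) := by
  unfold sigmaShift
  fun_prop

lemma sigmaShift_zero (L : PeriodPair) {ω : ℂ} (hω : ω ∉ L.lattice) : sigmaShift L ω 0 = 1 := by
  simp [sigmaShift, sigma_ne_zero L hω]

lemma differentiable_sigmaR (L : PeriodPair) (r : Fin 4) : Differentiable ℂ (sigmaR L r) := by
  fin_cases r
  · exact differentiable_sigma L
  all_goals exact differentiable_sigmaShift L _

lemma exists_sigmaR_ne_zero (L : PeriodPair) (r : Fin 4) : ∃ z, sigmaR L r z ≠ 0 := by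
  have h {ω : ℂ} (hω : ω ∉ L.lattice) : sigmaShift L ω 0 ≠ 0 := by
    rw [sigmaShift_zero L hω]
    exact one_ne_zero
  fin_cases r
  · exact ⟨_, sigma_ne_zero L (halfω₁_notMem_lattice L)⟩
  · exact ⟨0, h (halfω₁_notMem_lattice L)⟩
  · exact ⟨0, h (neg_halfω₁_sub_halfω₂_notMem_lattice L)⟩
  · exact ⟨0, h L.ω₂_div_two_notMem_lattice⟩

lemma eventually_ne_zero_nhdsNE {f : ℂ → ℂ} (hf : Differentiable ℂ f) (h : ∃ z, f z ≠ 0) (z : ℂ) :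
    ∀ᶠ y in 𝓝[≠] z, f y ≠ 0 := by
  refine (hf.analyticAt z).eventually_eq_zero_or_eventually_ne_zero.resolve_left fun h0 ↦ ?_
  have h1 : f = 0 := AnalyticOnNhd.eq_of_eventuallyEq (fun y _ ↦ hf.analyticAt y)
    (fun y _ ↦ analyticAt_const) h0
  obtain ⟨y, hy⟩ := h
  exact hy (congrFun h1 y)

/-- Numerator and denominator coincide and are nonzero on a punctured neighbourhood of every point.
The meromorphic normal form then restores the value 1 at the zeros of the denominator, where Lean's
quotient is 0. -/
lemma w_zero_zero (L : PeriodPair) (γ z : ℂ) : w L γ 0 0 z = 1 := by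
  set f : ℂ → ℂ := fun z ↦ ∏ r : Fin 4,
    sigmaR L r (z + (0 : Fin 4 → ℂ) r) * sigmaR L r (z + (0 : Fin 4 → ℂ) r + γ / 2) /
      (sigmaR L r z * sigmaR L r (z + γ / 2)) with hf
  have hev (x : ℂ) : f =ᶠ[𝓝[≠] x] fun _ ↦ 1 := by
    have h1 : ∀ᶠ y in 𝓝[≠] x, ∀ r, sigmaR L r y ≠ 0 := eventually_all.mpr fun r ↦
      eventually_ne_zero_nhdsNE (differentiable_sigmaR L r) (exists_sigmaR_ne_zero L r) x
    have h2 : ∀ᶠ y in 𝓝[≠] x, ∀ r, sigmaR L r (y + γ / 2) ≠ 0 := by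
      refine eventually_all.mpr fun r ↦ eventually_ne_zero_nhdsNE
        (f := fun y ↦ sigmaR L r (y + γ / 2)) ?_ ?_ x
      · exact (differentiable_sigmaR L r).comp (differentiable_id.add_const _)
      · obtain ⟨u, hu⟩ := exists_sigmaR_ne_zero L r
        exact ⟨u - γ / 2, by simpa using hu⟩
    filter_upwards [h1, h2] with y hy1 hy2
    simp only [hf, Pi.zero_apply, add_zero]
    exact Finset.prod_eq_one fun r _ ↦ div_self (mul_ne_zero (hy1 r) (hy2 r))
  have hm : MeromorphicOn f Set.univ := fun x _ ↦
    (MeromorphicAt.meromorphicAt_congr (hev x)).mpr (MeromorphicAt.const 1 x)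
  have h1 : w L γ 0 0 = toMeromorphicNFOn f Set.univ := rfl
  rw [h1, toMeromorphicNFOn_eq_toMeromorphicNFAt hm (Set.mem_univ z),
    (toMeromorphicNFAt_eventuallyEq_nhds_congr (hev z)).eq_of_nhds,
    toMeromorphicNFAt_eq_self.mpr analyticAt_const.meromorphicNFAt]

lemma c_zero_zero (L : PeriodPair) (γ μ : ℂ) (r : Fin 4) : c L γ μ 0 0 r = 0 := by
  have h : sigmaR L 0 0 = 0 := sigma_zero L
  rw [c, Finset.prod_eq_zero (Finset.mem_univ 0), mul_zero]
  simp [h]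

lemma UPairOne_zero_zero (L : PeriodPair) (γ μ : ℂ) (x : ℂ × ℂ) : UPairOne L γ μ 0 0 x = 0 := by
  simp [UPairOne, c_zero_zero]

/-- The sum of the two shift operators, for constant `w = 1`. -/
lemma H1bar_eq (L : PeriodPair) (γ : ℂ) (g : ℂ × ℂ → ℂ) (x : ℂ × ℂ) :
    H1bar L γ g x =
      (∑ ε : ℤˣ, v L (-γ) (sgn ε * x.1 + x.2) * v L (-γ) (sgn ε * x.1 - x.2) *
        g (x.1 + sgn ε * γ, x.2)) +
      ∑ ε : ℤˣ, v L (-γ) (sgn ε * x.2 + x.1) * v L (-γ) (sgn ε * x.2 - x.1) *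
        g (x.1, x.2 + sgn ε * γ) := by
  simp only [H1bar, H1, shiftOne, shiftTwo, UPairOne_zero_zero, w_zero_zero, one_mul, zero_mul,
    add_zero]

/-- Since U_{{j},1} = -2, the single shifts in 𝓗̄₂ are -2𝓗̄₁ and cancel. -/
lemma H2bar_add_two_mul_H1bar (L : PeriodPair) (γ : ℂ) (g : ℂ × ℂ → ℂ) (x : ℂ × ℂ) :
    H2bar L γ g x + 2 * H1bar L γ g x =
      ∑ ε : ℤˣ, ∑ δ : ℤˣ,
        (v L (-γ) (sgn ε * x.1 + sgn δ * x.2) * v L (-γ) (sgn ε * x.1 + sgn δ * x.2 + γ) *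
          g (x.1 + sgn ε * γ, x.2 + sgn δ * γ) +
        v L (-γ) (sgn ε * x.1 + sgn δ * x.2) * v L (-γ) (-(sgn ε * x.1) - sgn δ * x.2 - γ) *
          g x) := by
  simp only [H1bar, H2bar, H1, H2, USingle, UPairOne_zero_zero, UPairTwo, w_zero_zero, one_mul,
    zero_mul, add_zero, Finset.sum_add_distrib, Finset.sum_mul]
  ring

/-! ### The gauge transformation -/

lemma two_mul_halfω₁ (L : PeriodPair) : 2 * halfω₁ L = L.ω₁ := by
  rw [halfω₁]
  ring

lemma sgn_sq (ε : ℤˣ) : sgn ε ^ 2 = 1 := by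
  rcases Int.units_eq_one_or ε with rfl | rfl <;> simp [sgn]

lemma prod_units_int (F : ℂ → ℂ) : ∏ δ : ℤˣ, F (sgn δ) = F 1 * F (-1) := by
  have : (Finset.univ : Finset ℤˣ) = {1, -1} := rfl
  rw [this, Finset.prod_pair (by decide)]
  simp [sgn]

lemma gauge_apply (L : PeriodPair) (f : ℂ × ℂ → ℂ) (x : ℂ × ℂ) :
    gauge L f x = exp (eta1 L / halfω₁ L * (x.1 ^ 2 + x.2 ^ 2)) * f (x.1 / L.ω₁, x.2 / L.ω₁) := by
  rw [← two_mul_halfω₁, div_mul_eq_mul_div]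
  rfl

lemma gauge_symm_apply (L : PeriodPair) (g : ℂ × ℂ → ℂ) (a b : ℂ) :
    (gauge L).symm g (a / L.ω₁, b / L.ω₁) =
      exp (-(eta1 L / halfω₁ L * (a ^ 2 + b ^ 2))) * g (a, b) := by
  have h (a : ℂ) : 2 * halfω₁ L * (a / L.ω₁) = a := by
    rw [two_mul_halfω₁, mul_div_cancel₀ _ (ω₁_ne_zero L)]
  have : (gauge L).symm g (a / L.ω₁, b / L.ω₁) =
    exp (-(eta1 L * ((2 * halfω₁ L * (a / L.ω₁)) ^ 2 + (2 * halfω₁ L * (b / L.ω₁)) ^ 2) /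
      halfω₁ L)) * g (2 * halfω₁ L * (a / L.ω₁), 2 * halfω₁ L * (b / L.ω₁)) := rfl
  rw [this, h, h, div_mul_eq_mul_div]

lemma sigma_ne_zero_sgn (L : PeriodPair) {x : ℂ × ℂ} (h₁ : x.1 + x.2 ∉ L.lattice)
    (h₂ : x.1 - x.2 ∉ L.lattice) (ε δ : ℤˣ) : sigma L (sgn ε * x.1 + sgn δ * x.2) ≠ 0 := by
  have key {z : ℂ} (hz : z ∉ L.lattice) : sigma L z ≠ 0 ∧ sigma L (-z) ≠ 0 :=
    ⟨sigma_ne_zero L hz, by rw [sigma_neg]; exact neg_ne_zero.mpr (sigma_ne_zero L hz)⟩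
  rcases Int.units_eq_one_or ε with rfl | rfl <;> rcases Int.units_eq_one_or δ with rfl | rfl
  · convert (key h₁).1 using 2
    simp [sgn]
  · convert (key h₂).1 using 2
    simp [sgn, sub_eq_add_neg]
  · convert (key h₂).2 using 2
    simp [sgn]
    ring
  · convert (key h₁).2 using 2
    simp [sgn]
    ring

section

variable {L : PeriodPair} (hL : 0 < (ratio L).im)
include hL

/-- This also holds where the denominators vanish: θ₁ and σ vanish together, and both quotients are
then 0. -/
lemma theta1_div_theta1 (a b : ℂ) :
    theta1 (ratio L) (a / L.ω₁) / theta1 (ratio L) (b / L.ω₁) =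
      exp (eta1 L / halfω₁ L * (b ^ 2 - a ^ 2) / 2) * (sigma L a / sigma L b) := by
  obtain ⟨k, hk, h⟩ := exists_theta1_eq_mul_sigma hL
  rw [h, h, mul_div_mul_left _ _ hk, mul_div_mul_comm, ← exp_sub]
  ring_nf

/-- The two theta quotients contribute the exponent A(2eaγ - γ²) and the gauge factors -A(2eaγ +
γ²), using e² = 1; the sum is -2Aγ². -/
lemma gauge_theta1_shift {e : ℂ} (he : e ^ 2 = 1) (a b γ G : ℂ) :
    exp (eta1 L / halfω₁ L * (a ^ 2 + b ^ 2)) *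
      (theta1 (ratio L) ((e * a + b - γ) / L.ω₁) / theta1 (ratio L) ((e * a + b) / L.ω₁) *
        (theta1 (ratio L) ((e * a - b - γ) / L.ω₁) / theta1 (ratio L) ((e * a - b) / L.ω₁)) *
        (exp (-(eta1 L / halfω₁ L * ((a + e * γ) ^ 2 + b ^ 2))) * G)) =
    exp (-(2 * (eta1 L / halfω₁ L) * γ ^ 2)) *
      (v L (-γ) (e * a + b) * v L (-γ) (e * a - b) * G) := by
  rw [theta1_div_theta1 hL, theta1_div_theta1 hL, v, v, ← sub_eq_add_neg, ← sub_eq_add_neg]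
  generalize sigma L (e * a + b - γ) / sigma L (e * a + b) = X
  generalize sigma L (e * a - b - γ) / sigma L (e * a - b) = Y
  generalize eta1 L / halfω₁ L = A
  have : exp (-(2 * A * γ ^ 2)) = exp (A * (a ^ 2 + b ^ 2)) *
      exp (A * ((e * a + b) ^ 2 - (e * a + b - γ) ^ 2) / 2) *
      exp (A * ((e * a - b) ^ 2 - (e * a - b - γ) ^ 2) / 2) *
      exp (-(A * ((a + e * γ) ^ 2 + b ^ 2))) := by
    rw [← exp_add, ← exp_add, ← exp_add]
    congr 1
    linear_combination A * γ ^ 2 * he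
  rw [this]
  ring

lemma gauge_theta1_double_shift {d e : ℂ} (hd : d ^ 2 = 1) (he : e ^ 2 = 1) {a b γ : ℂ}
    (hne : sigma L (e * a + d * b) ≠ 0) (G : ℂ) :
    exp (eta1 L / halfω₁ L * (a ^ 2 + b ^ 2)) *
      (theta1 (ratio L) ((e * a + d * b - γ) / L.ω₁) /
        theta1 (ratio L) ((e * a + d * b + γ) / L.ω₁) *
        (exp (-(eta1 L / halfω₁ L * ((a + e * γ) ^ 2 + (b + d * γ) ^ 2))) * G)) =
    exp (-(2 * (eta1 L / halfω₁ L) * γ ^ 2)) *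
      (v L (-γ) (e * a + d * b) * v L (-γ) (e * a + d * b + γ) * G) := by
  -- The product telescopes: σ(z) cancels for z = ea + db, which requires σ(z) ≠ 0.
  have hv : v L (-γ) (e * a + d * b) * v L (-γ) (e * a + d * b + γ) =
      sigma L (e * a + d * b - γ) / sigma L (e * a + d * b + γ) := by
    rw [v, v, add_neg_cancel_right, ← sub_eq_add_neg, div_mul_div_cancel₀ hne]
  rw [theta1_div_theta1 hL, hv]
  generalize sigma L (e * a + d * b - γ) / sigma L (e * a + d * b + γ) = X
  generalize eta1 L / halfω₁ L = A
  have : exp (-(2 * A * γ ^ 2)) = exp (A * (a ^ 2 + b ^ 2)) *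
      exp (A * ((e * a + d * b + γ) ^ 2 - (e * a + d * b - γ) ^ 2) / 2) *
      exp (-(A * ((a + e * γ) ^ 2 + (b + d * γ) ^ 2))) := by
    rw [← exp_add, ← exp_add]
    congr 1
    linear_combination A * γ ^ 2 * (hd + he)
  rw [this]
  ring

lemma gauge_theta1_potential (a b γ z G : ℂ) :
    exp (eta1 L / halfω₁ L * (a ^ 2 + b ^ 2)) *
      (theta1 (ratio L) ((z - γ) / L.ω₁) * theta1 (ratio L) ((z + 2 * γ) / L.ω₁) /
        (theta1 (ratio L) (z / L.ω₁) * theta1 (ratio L) ((z + γ) / L.ω₁)) *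
        (exp (-(eta1 L / halfω₁ L * (a ^ 2 + b ^ 2))) * G)) =
    exp (-(2 * (eta1 L / halfω₁ L) * γ ^ 2)) *
      (v L (-γ) z * v L (-γ) (-z - γ) * G) := by
  -- Oddness of σ turns the reflected argument into the second theta quotient of the potential.
  have hv : v L (-γ) (-z - γ) = sigma L (z + 2 * γ) / sigma L (z + γ) := by
    have h1 : -z - γ + -γ = -(z + 2 * γ) := by ring
    have h2 : -z - γ = -(z + γ) := by ring
    rw [v, h1, h2, sigma_neg, sigma_neg, neg_div_neg_eq]
  rw [mul_div_mul_comm, theta1_div_theta1 hL, theta1_div_theta1 hL, hv, v, ← sub_eq_add_neg]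
  generalize sigma L (z - γ) / sigma L z = X
  generalize sigma L (z + 2 * γ) / sigma L (z + γ) = Y
  generalize eta1 L / halfω₁ L = A
  have : exp (-(2 * A * γ ^ 2)) = exp (A * (a ^ 2 + b ^ 2)) *
      exp (A * (z ^ 2 - (z - γ) ^ 2) / 2) * exp (A * ((z + γ) ^ 2 - (z + 2 * γ) ^ 2) / 2) *
      exp (-(A * (a ^ 2 + b ^ 2))) := by
    rw [← exp_add, ← exp_add, ← exp_add]
    congr 1
    ring
  rw [this]
  ring

lemma gauge_M1 (γ : ℂ) (g : ℂ × ℂ → ℂ) (x : ℂ × ℂ) :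
    gauge L (M1 (ratio L) (γ / L.ω₁) ((gauge L).symm g)) x =
      exp (-(2 * (eta1 L / halfω₁ L) * γ ^ 2)) * H1bar L γ g x := by
  have hdiv (e a : ℂ) : e * (a / L.ω₁) = e * a / L.ω₁ := by ring
  have hadd (a b : ℂ) : a / L.ω₁ + b / L.ω₁ = (a + b) / L.ω₁ := by ring
  have hsub (a b : ℂ) : a / L.ω₁ - b / L.ω₁ = (a - b) / L.ω₁ := by ring
  rw [gauge_apply, H1bar_eq, M1, mul_add (exp _), mul_add (exp _), Finset.mul_sum,
    Finset.mul_sum, Finset.mul_sum,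
    Finset.mul_sum]
  congr 1 <;> refine Finset.sum_congr rfl fun ε _ ↦ ?_
  · rw [prod_units_int fun d ↦ theta1 (ratio L) (sgn ε * (x.1 / L.ω₁) + d * (x.2 / L.ω₁) -
      γ / L.ω₁) / theta1 (ratio L) (sgn ε * (x.1 / L.ω₁) + d * (x.2 / L.ω₁))]
    simp only [one_mul, neg_one_mul, ← sub_eq_add_neg, hdiv, hadd, hsub, gauge_symm_apply]
    exact gauge_theta1_shift hL (sgn_sq ε) x.1 x.2 γ _
  · rw [prod_units_int fun d ↦ theta1 (ratio L) (sgn ε * (x.2 / L.ω₁) + d * (x.1 / L.ω₁) -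
      γ / L.ω₁) / theta1 (ratio L) (sgn ε * (x.2 / L.ω₁) + d * (x.1 / L.ω₁))]
    simp only [one_mul, neg_one_mul, ← sub_eq_add_neg, hdiv, hadd, hsub, gauge_symm_apply]
    rw [add_comm (x.1 ^ 2), add_comm (x.1 ^ 2)]
    exact gauge_theta1_shift hL (sgn_sq ε) x.2 x.1 γ _

lemma gauge_M2 (γ : ℂ) (g : ℂ × ℂ → ℂ) {x : ℂ × ℂ} (h₁ : x.1 + x.2 ∉ L.lattice)
    (h₂ : x.1 - x.2 ∉ L.lattice) :
    gauge L (M2 (ratio L) (γ / L.ω₁) ((gauge L).symm g)) x =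
      exp (-(2 * (eta1 L / halfω₁ L) * γ ^ 2)) * (H2bar L γ g x + 2 * H1bar L γ g x) := by
  have hdiv (e d a b : ℂ) :
      e * (a / L.ω₁) + d * (b / L.ω₁) = (e * a + d * b) / L.ω₁ := by ring
  have hshift (e a : ℂ) : a / L.ω₁ + e * (γ / L.ω₁) = (a + e * γ) / L.ω₁ := by ring
  have h2γ : 2 * (γ / L.ω₁) = (2 * γ) / L.ω₁ := by ring
  rw [gauge_apply, H2bar_add_two_mul_H1bar, M2, Finset.mul_sum, Finset.mul_sum]
  refine Finset.sum_congr rfl fun ε _ ↦ ?_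
  rw [Finset.mul_sum, Finset.mul_sum]
  refine Finset.sum_congr rfl fun δ _ ↦ ?_
  simp only [hdiv, hshift, h2γ, ← sub_div, ← add_div, gauge_symm_apply]
  rw [mul_add (exp _), mul_add (exp _), ← neg_add']
  congr 1
  · exact gauge_theta1_double_shift hL (sgn_sq δ) (sgn_sq ε) (sigma_ne_zero_sgn L h₁ h₂ ε δ) _
  · exact gauge_theta1_potential hL x.1 x.2 γ _ _

end

end EllipticC2

end

open EllipticC2 in
theorem theorem2 (L : PeriodPair) (hτ : 0 < (halfω₂ L / halfω₁ L).im) (h γ : ℂ)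
    (hγ : γ = 2 * halfω₁ L * h) :
    (∀ (g : ℂ × ℂ → ℂ) (x : ℂ × ℂ), x.1 + x.2 ∉ L.lattice → x.1 - x.2 ∉ L.lattice →
      gauge L (M1 (halfω₂ L / halfω₁ L) h ((gauge L).symm g)) x =
        Complex.exp (-(2 * eta1 L * γ ^ 2 / halfω₁ L)) * H1bar L γ g x) ∧
    (∀ (g : ℂ × ℂ → ℂ) (x : ℂ × ℂ),
      (∀ z ∈ ({x.1 + x.2, x.1 - x.2} : Set ℂ),
        z ∉ L.lattice ∧ z + γ ∉ L.lattice ∧ z - γ ∉ L.lattice) →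
      gauge L (M2 (halfω₂ L / halfω₁ L) h ((gauge L).symm g)) x =
        Complex.exp (-(2 * eta1 L * γ ^ 2 / halfω₁ L)) *
          (H2bar L γ g x + 2 * H1bar L γ g x)) := by
  rw [ratio_eq] at hτ ⊢
  have hh : h = γ / L.ω₁ := by
    rw [hγ, two_mul_halfω₁, mul_div_cancel_left₀ _ (ω₁_ne_zero L)]
  have hA : 2 * eta1 L * γ ^ 2 / halfω₁ L = 2 * (eta1 L / halfω₁ L) * γ ^ 2 := by ring
  rw [hh, hA]
  exact ⟨fun g x _ _ ↦ gauge_M1 hτ γ g x,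
    fun g x hx ↦ gauge_M2 hτ γ g (hx _ (by simp)).1 (hx _ (by simp)).1⟩
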